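/- **Theorem (Bounds for the PCA).** Let $n\ge 1$ and $0\le M\le n$. Let $\mathbf S$ and $\mathbf N$ be independent $\mathbb R^n$-valued random vectors with finite second moments, and let $\mathbf X=\mathbf S+\mathbf N$. Assume that the law of $\mathbf N$ has a density with respect to Lebesgue measure, that the covariance matrix $\mathbf C_{\mathbf S}$ of $\mathbf S$ has rank at most $M$, and that the covariance matrix $\mathbf C_{\mathbf N}$ of $\mathbf N$ has full rank. Let $\mu_1\ge\mu_2\ge\dots\ge\mu_n>0$ be the eigenvalues of $\mathbf C_{\mathbf N}$, listed with multiplicity. Let $\mathbf W$ be an orthogonal matrix whose columns are eigenvectors of the covariance matrix of $\mathbf X$, arranged by decreasing eigenvalue (PCA). Put $\mathbf Y=\mathbf W^T\mathbf X$ and $\tilde{\mathbf N}=\mathbf W^T\mathbf N$. Write $\mathbf Y_M,\tilde{\mathbf N}_M$ for the first $M$ entries of these vectors and $\mathbf Y_c,\tilde{\mathbf N}_c$ for their last $n-M$ entries. For random vectors $U,V$ with a joint density and finite second moments, let $(U_G,V_G)$ be jointly Gaussian with the same joint first and second moments as $(U,V)$, and let $$J(U|V)=D(U|V\,\|\,U_G|V_G)=\int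 D\big(P_{U|V=v}\,\big\|\,P_{U_G|V_G=v}\big)\,dP_V(v)\in[0,\infty]$$ be the conditional divergence (equal to $h(U_G|V_G)-h(U|V)$, where $h$ is differential entropy). Assume that $J(\tilde{\mathbf N}_c|\tilde{\mathbf N}_M)$ is finite (equivalently, that $h(\tilde{\mathbf N}_c|\tilde{\mathbf N}_M)$ is finite) and that $\mathbf N$ is more Gaussian than $\mathbf Y$ in the sense $$J(\tilde{\mathbf N}_c|\tilde{\mathbf N}_M)\le J(\mathbf Y_c|\mathbf Y_M).$$ Then the information loss relevant with respect to $\mathbf S$, $$L_{\mathbf S}(\mathbf X\to\mathbf Y_M)=\sup_{\hat{\mathbf S}}\big(I(\hat{\mathbf S};\mathbf X)-I(\hat{\mathbf S};\mathbf Y_M)\big),$$ where the supremum is over all quantizations $\hat{\mathbf S}$ of $\mathbf S$ by finite measurable partitions of $\mathbb R^n$ and $I$ is mutual information in nats, satisfies $$L_{\mathbf S}(\mathbf X\to\mathbf Y_M)\le\frac12\ln\left(\prod_{i=M+1}^{n}\frac{\mu_1}{\mu_i}\right).$$ -/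

import Mathlib

open MeasureTheory ProbabilityTheory
open scoped ENNReal

noncomputable section

namespace PCALoss

/-- The mutual information `I(X; Y) = D(P_{XY} ‖ P_X ⊗ P_Y)` in nats. -/
def mutualInfo {Ω α β : Type*} [MeasurableSpace Ω] [MeasurableSpace α] [MeasurableSpace β]
    (X : Ω → α) (Y : Ω → β) (P : Measure Ω) : ℝ≥0∞ :=
  InformationTheory.klDiv (P.map (fun ω => (X ω, Y ω))) ((P.map X).prod (P.map Y))

/-- The information loss relevant with respect to `S` that is incurred by passing from `X` to
`g(X)`: the supremum of `I(Ŝ; X) - I(Ŝ; g(X))` over the quantizations `Ŝ = q(S)` of `S` by finite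
measurable partitions (the cells being the fibres of `q`). Both mutual informations are finite
for such `Ŝ`, so the difference is a genuine one. -/
def relevantLoss {Ω σ α β : Type*} [MeasurableSpace Ω] [MeasurableSpace σ] [MeasurableSpace α]
    [MeasurableSpace β] (S : Ω → σ) (X : Ω → α) (g : α → β) (P : Measure Ω) : EReal :=
  ⨆ (k : ℕ) (q : σ → Fin k) (_ : Measurable q),
    ((mutualInfo (fun ω => q (S ω)) X P : EReal) -
      (mutualInfo (fun ω => q (S ω)) (fun ω => g (X ω)) P : EReal))

section Moments

variable {Ω ι : Type*} [MeasurableSpace Ω]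

/-- The mean vector of a random vector. -/
def meanVec (Z : Ω → EuclideanSpace ℝ ι) (P : Measure Ω) : EuclideanSpace ℝ ι :=
  WithLp.toLp 2 (fun i => ∫ ω, Z ω i ∂P)

/-- The covariance matrix of a random vector. -/
def covMatrix (Z : Ω → EuclideanSpace ℝ ι) (P : Measure Ω) : Matrix ι ι ℝ :=
  Matrix.of (fun i j => cov[fun ω => Z ω i, fun ω => Z ω j; P])

theorem covMatrix_isHermitian (Z : Ω → EuclideanSpace ℝ ι) (P : Measure Ω) :
    (covMatrix Z P).IsHermitian := by
  ext i j
  simp [covMatrix, covariance_comm]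

end Moments

section ConditionalDivergence

variable {Ω ι κ : Type*} [MeasurableSpace Ω] [Fintype ι] [DecidableEq ι] [Fintype κ]
  [DecidableEq κ]

/-- The vector `(a, b)` obtained by stacking two vectors. -/
def stack (a : EuclideanSpace ℝ κ) (b : EuclideanSpace ℝ ι) : EuclideanSpace ℝ (κ ⊕ ι) :=
  WithLp.toLp 2 (Sum.elim (fun k => a k) (fun i => b i))

/-- The law of a jointly Gaussian pair `(Y_G, X_G)` which has the same joint first and second
moments as `(Y, X)`. -/
def gaussianPairLaw (Y : Ω → EuclideanSpace ℝ κ) (X : Ω → EuclideanSpace ℝ ι) (P : Measure Ω) :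
    Measure (EuclideanSpace ℝ κ × EuclideanSpace ℝ ι) :=
  (multivariateGaussian (meanVec (fun ω => stack (Y ω) (X ω)) P)
      (covMatrix (fun ω => stack (Y ω) (X ω)) P)).map
    (fun z => (WithLp.toLp 2 (fun k => z (Sum.inl k)), WithLp.toLp 2 (fun i => z (Sum.inr i))))

instance (Y : Ω → EuclideanSpace ℝ κ) (X : Ω → EuclideanSpace ℝ ι) (P : Measure Ω) :
    IsFiniteMeasure (gaussianPairLaw Y X P) := by
  unfold gaussianPairLaw
  infer_instance

/-- The conditional divergence `J(X|Y) = D(X|Y ‖ X_G|Y_G)`, that is, the average over the law of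
`Y` of the Kullback-Leibler divergence of the conditional law of `X` given `Y = y` from the
conditional law of `X_G` given `Y_G = y`. For random vectors with a joint density and finite
second moments it equals `h(X_G|Y_G) - h(X|Y)`. -/
def condDivergence (X : Ω → EuclideanSpace ℝ ι) (Y : Ω → EuclideanSpace ℝ κ) (P : Measure Ω)
    [IsFiniteMeasure P] : ℝ≥0∞ :=
  InformationTheory.klDiv
    ((P.map Y).compProd (condDistrib X Y P))
    ((P.map Y).compProd (gaussianPairLaw Y X P).condKernel)

end ConditionalDivergence

/-- `W` is a PCA matrix for the covariance matrix `C`: an orthogonal matrix whose columns are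
eigenvectors of `C`, arranged by decreasing eigenvalue. -/
def IsPCAMatrix {n : ℕ} (C W : Matrix (Fin n) (Fin n) ℝ) : Prop :=
  W ∈ Matrix.orthogonalGroup (Fin n) ℝ ∧
    ∃ l : Fin n → ℝ, Antitone l ∧ C * W = W * Matrix.diagonal l

/-- The rotation `x ↦ Wᵀ x`. -/
def rotate {n : ℕ} (W : Matrix (Fin n) (Fin n) ℝ) (x : EuclideanSpace ℝ (Fin n)) :
    EuclideanSpace ℝ (Fin n) :=
  WithLp.toLp 2 (Matrix.mulVec W.transpose (fun i => x i))

/-- The first `M` entries of a vector of length `M + K`. -/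
def firstPart {M K : ℕ} (y : EuclideanSpace ℝ (Fin (M + K))) : EuclideanSpace ℝ (Fin M) :=
  WithLp.toLp 2 (fun i => y (Fin.castAdd K i))

/-- The last `K` entries of a vector of length `M + K`. -/
def lastPart {M K : ℕ} (y : EuclideanSpace ℝ (Fin (M + K))) : EuclideanSpace ℝ (Fin K) :=
  WithLp.toLp 2 (fun j => y (Fin.natAdd M j))

/-- The eigenvalues, with multiplicity and in decreasing order, of a symmetric matrix. -/
def sortedEigenvalues {n : ℕ} {A : Matrix (Fin n) (Fin n) ℝ} (hA : A.IsHermitian) (i : Fin n) :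
    ℝ :=
  hA.eigenvalues₀ (Fin.cast (Fintype.card_fin n).symm i)

end PCALoss

end

noncomputable section

namespace PCALoss

/-! ### Divergence: invariance, chain rule and change of reference measure. -/

section KullbackLeibler

open InformationTheory

variable {α β γ : Type*} [MeasurableSpace α] [MeasurableSpace β] [MeasurableSpace γ]

/-! Put `Y = WᵀX` and let `R` be the residual of the affine regression of `Y_c` on `Y_M`. Since `X`
is a measurable function of `(Y_M, R)`, it suffices to bound `I(Ŝ; Y_M, R) - I(Ŝ; Y_M)`. Let `ν` be
the centred Gaussian law with the covariance of `R`, which is the Schur complement `Σ_Y` in `cov Y`.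
A Gaussian pair is an independent pair up to the regression shear, so `J(Y_c|Y_M) = D(P_{Y_M R} ‖
P_{Y_M} ⊗ ν)` (`condDivergence_eq_klDiv_residual`). The chain rule `mutualInfo_pair_add_klDiv` then
reads `I(Ŝ; Y_M, R) + J(Y_c|Y_M) = I(Ŝ; Y_M) + D(P_{Ŝ Y_M R} ‖ P_{Ŝ Y_M} ⊗ ν)`, and data processing
bounds the last term by the same divergence with `S` for `Ŝ`.

Conditionally on `S`, the signal only shifts the noise. So this divergence is `J(Ñ_c|Ñ_M)` up to a
change of Gaussian reference. Both residuals have the second moments of their references, so the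
change contributes exactly `½ (log det Σ_Y - log det Σ_N)` (`klDiv_residual_eq`). The assumption
that `N` is more Gaussian than `Y` removes the two `J` terms.

The determinants remain. PCA makes `cov Y` diagonal, so `det Σ_Y` is the product of its last `K`
eigenvalues, each at most `μ₁` by Weyl's inequality because `cov S` has rank at most `M`. On the
other side, `det Σ_N` is `det C_N` divided by the determinant of an `M × M` compression of `C_N`,
which is at most `μ₁⋯μ_M` by Cauchy interlacing; hence `det Σ_N` is at least the product of the
remaining `μ_i`. -/

theorem klDiv_map_of_leftInverse (μ ν : Measure α) [IsFiniteMeasure μ] [IsFiniteMeasure ν]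
    {f : α → β} {g : β → α} (hf : Measurable f) (hg : Measurable g)
    (h : Function.LeftInverse g f) : klDiv (μ.map f) (ν.map f) = klDiv μ ν := by
  refine le_antisymm (klDiv_map_le μ ν hf) ?_
  have := klDiv_map_le (μ.map f) (ν.map f) hg
  rwa [Measure.map_map hg hf, Measure.map_map hg hf, h.comp_eq_id, Measure.map_id,
    Measure.map_id] at this

/-- Chain rule for the divergence from a product measure. -/
theorem klDiv_prod_right_eq_add [StandardBorelSpace β] [Nonempty β] (ρ : Measure (α × β))
    [IsFiniteMeasure ρ] (μ : Measure α) [IsFiniteMeasure μ] (ν : Measure β)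
    [IsProbabilityMeasure ν] :
    klDiv ρ (μ.prod ν) = klDiv ρ.fst μ + klDiv ρ (ρ.fst.prod ν) := by
  have h := klDiv_compProd_eq_add ρ.fst μ ρ.condKernel (Kernel.const α ν)
  rwa [Measure.disintegrate, Measure.compProd_const, Measure.compProd_const] at h

theorem klDiv_prod_const (μ μ' : Measure α) [IsFiniteMeasure μ] [IsFiniteMeasure μ']
    (ν : Measure β) [IsProbabilityMeasure ν] :
    klDiv (μ.prod ν) (μ'.prod ν) = klDiv μ μ' := by
  have h := klDiv_compProd_left μ μ' (Kernel.const α ν)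
  rwa [Measure.compProd_const, Measure.compProd_const] at h

/-- Change of the reference measure in the divergence, for a reference with log-density `φ`. -/
theorem klDiv_withDensity_exp {μ ξ : Measure α} [IsProbabilityMeasure μ] [IsProbabilityMeasure ξ]
    {φ : α → ℝ} (hφ : Measurable φ)
    [IsProbabilityMeasure (ξ.withDensity fun x => ENNReal.ofReal (Real.exp (φ x)))]
    (hfin : klDiv μ ξ ≠ ∞) (hφμ : Integrable φ μ) :
    klDiv μ (ξ.withDensity fun x => ENNReal.ofReal (Real.exp (φ x))) ≠ ∞ ∧
      (klDiv μ (ξ.withDensity fun x => ENNReal.ofReal (Real.exp (φ x)))).toReal =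
        (klDiv μ ξ).toReal - ∫ x, φ x ∂μ := by
  obtain ⟨hac, hint⟩ := klDiv_ne_top_iff.1 hfin
  have hone : ∫⁻ x, ENNReal.ofReal (Real.exp (φ x)) ∂ξ = 1 := by
    have := measure_univ (μ := ξ.withDensity fun x => ENNReal.ofReal (Real.exp (φ x)))
    rwa [withDensity_apply _ MeasurableSet.univ, setLIntegral_univ] at this
  have hexp : Integrable (fun x => Real.exp (φ x)) ξ := by
    refine ⟨by fun_prop, ?_⟩
    rw [hasFiniteIntegral_iff_ofReal (Filter.Eventually.of_forall fun x => (Real.exp_pos _).le),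
      hone]
    exact ENNReal.one_lt_top
  have hI : ∫ x, Real.exp (φ x) ∂ξ = 1 := by
    rw [integral_eq_lintegral_of_nonneg_ae
      (Filter.Eventually.of_forall fun x => (Real.exp_pos _).le) (by fun_prop), hone]
    simp
  -- As `exp φ` has `ξ`-integral one, the normalising constant of the tilted measure is trivial.
  have htilt : ξ.tilted φ = ξ.withDensity fun x => ENNReal.ofReal (Real.exp (φ x)) := by
    simp [Measure.tilted, hI]
  have hac' : μ ≪ ξ.tilted φ := hac.trans (absolutelyContinuous_tilted hexp)
  have : IsProbabilityMeasure (ξ.tilted φ) := isProbabilityMeasure_tilted hexp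
  rw [← htilt]
  refine ⟨klDiv_ne_top hac' (integrable_llr_tilted_right hac hφμ hint hexp), ?_⟩
  rw [toReal_klDiv_of_measure_eq hac' (by simp), toReal_klDiv_of_measure_eq hac (by simp),
    integral_llr_tilted_right hac hφμ hexp hint, hI]
  simp

/-- A change of variables which shifts the last component, applied to a product measure whose
second factor has a log-density with respect to a translation invariant measure. -/
theorem map_shift_withDensity_exp [AddGroup β] [MeasurableAdd₂ β] [MeasurableNeg β]
    (ξ : Measure β) [SFinite ξ] [ξ.IsAddRightInvariant] (μ : Measure α) [SFinite μ]
    {f g : β → ℝ} (hf : Measurable f) (hg : Measurable g) {c : α → β} (hc : Measurable c)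
    {h : α → γ} (hh : Measurable h) :
    (((μ.prod (ξ.withDensity fun x => ENNReal.ofReal (Real.exp (g x)))).withDensity
      fun p => ENNReal.ofReal (Real.exp (f (p.2 + c p.1) - g p.2))).map
        fun p => (h p.1, p.2 + c p.1)) =
      (μ.map h).prod (ξ.withDensity fun x => ENNReal.ofReal (Real.exp (f x))) := by
  have : SFinite (μ.map h) := inferInstance
  refine Measure.ext_of_lintegral _ fun F hF => ?_
  rw [lintegral_map hF (by fun_prop), lintegral_withDensity_eq_lintegral_mul _ (by fun_prop)
    (by fun_prop), lintegral_prod _ (by fun_prop), lintegral_prod _ (by fun_prop),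
    lintegral_map (by fun_prop) hh]
  refine lintegral_congr fun a => ?_
  rw [lintegral_withDensity_eq_lintegral_mul _ (by fun_prop) (by fun_prop),
    lintegral_withDensity_eq_lintegral_mul _ (by fun_prop) (by fun_prop)]
  -- For fixed `a`, the factors `exp (g y)` cancel and the substitution `y ↦ y + c a` preserves `ξ`.
  refine Eq.trans (lintegral_congr fun y => ?_) (lintegral_add_right_eq_self _ (c a))
  simp only [Pi.mul_apply]
  rw [← mul_assoc, ← ENNReal.ofReal_mul (Real.exp_pos _).le, ← Real.exp_add]
  congr 4
  ring

end KullbackLeibler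

/-! ### Mutual information: data processing and chain rule. -/

section Information

variable {Ω σ α β δ : Type*} [MeasurableSpace Ω] [MeasurableSpace σ] [MeasurableSpace α]
  [MeasurableSpace β] [MeasurableSpace δ]

/-- Data processing for the map `id × g`, which sends the product of the marginals to the product of
the new marginals. -/
theorem mutualInfo_comp_le (P : Measure Ω) [IsFiniteMeasure P] {T : Ω → σ} {X : Ω → α}
    (hT : Measurable T) (hX : Measurable X) {g : α → β} (hg : Measurable g) :
    mutualInfo T (fun ω => g (X ω)) P ≤ mutualInfo T X P := by
  have h := InformationTheory.klDiv_map_le (P.map fun ω => (T ω, X ω))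
    ((P.map T).prod (P.map X)) (measurable_id.prodMap hg)
  rw [Measure.map_map (by fun_prop) (by fun_prop), ← Measure.map_prod_map _ _ measurable_id hg,
    Measure.map_map hg hX, Measure.map_id] at h
  exact h

/-- The chain rule `I(T; (Y, R)) + D(P_{YR} ‖ P_Y ⊗ ν) = I(T; Y) + D(P_{TYR} ‖ P_{TY} ⊗ ν)`. -/
theorem mutualInfo_pair_add_klDiv [StandardBorelSpace σ] [Nonempty σ]
    [StandardBorelSpace β] [Nonempty β] (P : Measure Ω) [IsProbabilityMeasure P]
    {T : Ω → σ} {Y : Ω → α} {R : Ω → β} (hT : Measurable T) (hY : Measurable Y)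
    (hR : Measurable R) (ν : Measure β) [IsProbabilityMeasure ν] :
    mutualInfo T (fun ω => (Y ω, R ω)) P +
        InformationTheory.klDiv (P.map fun ω => (Y ω, R ω)) ((P.map Y).prod ν) =
      mutualInfo T Y P + InformationTheory.klDiv (P.map fun ω => ((T ω, Y ω), R ω))
        ((P.map fun ω => (T ω, Y ω)).prod ν) := by
  have : IsProbabilityMeasure (P.map T) := Measure.isProbabilityMeasure_map hT.aemeasurable
  have : IsProbabilityMeasure (P.map Y) := Measure.isProbabilityMeasure_map hY.aemeasurable
  have : IsProbabilityMeasure (P.map fun ω => (T ω, Y ω)) :=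
    Measure.isProbabilityMeasure_map (by fun_prop)
  have : IsProbabilityMeasure (P.map fun ω => (Y ω, R ω)) :=
    Measure.isProbabilityMeasure_map (by fun_prop)
  -- The divergence of the law of `(T, Y, R)` from `P_T ⊗ P_Y ⊗ ν` is expanded twice: `h1` splits
  -- off `R`, `h2` splits off `T`.
  have h1 := klDiv_prod_right_eq_add (P.map fun ω => ((T ω, Y ω), R ω))
    ((P.map T).prod (P.map Y)) ν
  rw [Measure.fst_map_prodMk (by fun_prop)] at h1
  have h2 := klDiv_prod_right_eq_add (P.map fun ω => ((Y ω, R ω), T ω))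
    ((P.map Y).prod ν) (P.map T)
  rw [Measure.fst_map_prodMk (by fun_prop)] at h2
  have h3 := klDiv_map_of_leftInverse (P.map fun ω => ((T ω, Y ω), R ω))
    (((P.map T).prod (P.map Y)).prod ν) (f := fun p => ((p.1.2, p.2), p.1.1))
    (g := fun p => ((p.2, p.1.1), p.1.2)) (by fun_prop) (by fun_prop) (fun _ => rfl)
  have h4 := klDiv_map_of_leftInverse (P.map fun ω => (T ω, (Y ω, R ω)))
    ((P.map T).prod (P.map fun ω => (Y ω, R ω))) measurable_swap measurable_swap
    (fun _ => rfl)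
  have h5 : (((P.map T).prod (P.map Y)).prod ν).map
      (fun p : (σ × α) × β => ((p.1.2, p.2), p.1.1)) =
      ((P.map Y).prod ν).prod (P.map T) := by
    have e : (fun p : (σ × α) × β => ((p.1.2, p.2), p.1.1)) =
      Prod.swap ∘ (MeasurableEquiv.prodAssoc : (σ × α) × β ≃ᵐ _) := rfl
    rw [e, ← Measure.map_map measurable_swap MeasurableEquiv.prodAssoc.measurable,
      Measure.prodAssoc_prod, Measure.prod_swap]
  rw [Measure.prod_swap, Measure.map_map measurable_swap (by fun_prop)] at h4
  rw [h5, Measure.map_map (by fun_prop) (by fun_prop)] at h3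
  simp only [mutualInfo]
  rw [← h1, ← h3, ← h4, add_comm]
  exact h2.symm

/-- Data processing for `q × id × id`; it makes the final bound uniform over all quantizations. -/
theorem klDiv_quantization_le {P : Measure Ω} [IsFiniteMeasure P] {S : Ω → δ} {Y : Ω → α}
    {R : Ω → β} (hS : Measurable S) (hY : Measurable Y) (hR : Measurable R) (ν : Measure β)
    [IsFiniteMeasure ν] {q : δ → σ} (hq : Measurable q) :
    InformationTheory.klDiv (P.map fun ω => ((q (S ω), Y ω), R ω))
        ((P.map fun ω => (q (S ω), Y ω)).prod ν) ≤
      InformationTheory.klDiv (P.map fun ω => ((S ω, Y ω), R ω))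
        ((P.map fun ω => (S ω, Y ω)).prod ν) := by
  have hg : Measurable (Prod.map q (id : α → α)) := hq.prodMap measurable_id
  have h := InformationTheory.klDiv_map_le (P.map fun ω => ((S ω, Y ω), R ω))
    ((P.map fun ω => (S ω, Y ω)).prod ν) (hg.prodMap (measurable_id (α := β)))
  rw [Measure.map_map (by fun_prop) (by fun_prop), ← Measure.map_prod_map _ _ hg measurable_id,
    Measure.map_map hg (by fun_prop), Measure.map_id] at h
  exact h

end Information

/-! ### Lebesgue densities of Gaussian laws. -/

section GaussianDensity

open Matrix Module
open scoped RealInnerProductSpace MatrixOrder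

variable {ι κ : Type*} [Fintype ι] [DecidableEq ι] [Fintype κ] [DecidableEq κ]

/-- The logarithm of the density of the centred Gaussian law with covariance matrix `S`. -/
def gaussLogDensity (S : Matrix ι ι ℝ) (x : EuclideanSpace ℝ ι) : ℝ :=
  -(Fintype.card ι / 2 * Real.log (2 * Real.pi)) - 1 / 2 * Real.log S.det -
    1 / 2 * (x.ofLp ⬝ᵥ S⁻¹ *ᵥ x.ofLp)

@[fun_prop]
theorem measurable_gaussLogDensity (S : Matrix ι ι ℝ) : Measurable (gaussLogDensity S) := by
  have h : Continuous fun x : EuclideanSpace ℝ ι => x.ofLp ⬝ᵥ S⁻¹ *ᵥ x.ofLp := by fun_prop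
  have := h.measurable
  unfold gaussLogDensity
  fun_prop

/-- Both sides have the same characteristic function, by the Gaussian Fourier integral with
parameter `1 / 2`. -/
theorem stdGaussian_eq_withDensity {ι : Type*} [Fintype ι] :
    stdGaussian (EuclideanSpace ℝ ι) =
      volume.withDensity fun x => ENNReal.ofReal
        (Real.exp (-(Fintype.card ι / 2 * Real.log (2 * Real.pi)) - 1 / 2 * ‖x‖ ^ 2)) := by
  set f : EuclideanSpace ℝ ι → ℝ := fun x =>
    Real.exp (-(Fintype.card ι / 2 * Real.log (2 * Real.pi)) - 1 / 2 * ‖x‖ ^ 2) with hf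
  have hfm : Measurable f := by fun_prop
  have key (t : EuclideanSpace ℝ ι) := GaussianFourier.integral_cexp_neg_mul_sq_norm_add
    (b := 1 / 2) (by norm_num) Complex.I t
  have hfint : Integrable f volume := by
    have h0 := (GaussianFourier.integrable_cexp_neg_mul_sq_norm_add (b := 1 / 2) (by norm_num) 0
      (0 : EuclideanSpace ℝ ι)).norm
    refine (h0.const_mul (Real.exp (-(Fintype.card ι / 2 * Real.log (2 * Real.pi))))).congr
      (Filter.Eventually.of_forall fun x => ?_)
    simp only [hf, Complex.norm_exp]
    rw [← Real.exp_add]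
    congr 1
    simp [← Complex.ofReal_pow]
    ring
  have : IsFiniteMeasure (volume.withDensity fun x => ENNReal.ofReal (f x)) :=
    isFiniteMeasure_withDensity_ofReal hfint.2
  apply Measure.ext_of_charFun
  ext t
  rw [charFun_stdGaussian, charFun_apply,
    integral_withDensity_eq_integral_toReal_smul (by fun_prop) (by simp)]
  have hpt (x : EuclideanSpace ℝ ι) : (ENNReal.ofReal (f x)).toReal • Complex.exp
      (⟪x, t⟫ * Complex.I)
      = Real.exp (-(Fintype.card ι / 2 * Real.log (2 * Real.pi))) *
        Complex.exp (-(1 / 2) * ‖x‖ ^ 2 + Complex.I * ⟪t, x⟫) := by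
    rw [ENNReal.toReal_ofReal (Real.exp_pos _).le, Complex.real_smul, Complex.ofReal_exp,
      Complex.ofReal_exp, ← Complex.exp_add, ← Complex.exp_add, real_inner_comm]
    congr 1
    push_cast
    ring
  rw [integral_congr_ae (Filter.Eventually.of_forall hpt), integral_const_mul, key t,
      finrank_euclideanSpace]
  have hpi : ((Real.pi : ℂ) / (1 / 2)) = ((2 * Real.pi : ℝ) : ℂ) := by push_cast; ring
  have hpow : ((2 * Real.pi : ℝ) : ℂ) ^ ((Fintype.card ι : ℂ) / 2) =
      ((Real.exp (Fintype.card ι / 2 * Real.log (2 * Real.pi)) : ℝ) : ℂ) := by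
    rw [show ((Fintype.card ι : ℂ) / 2) = ((Fintype.card ι / 2 : ℝ) : ℂ) by push_cast; ring,
      ← Complex.ofReal_cpow (by positivity), Real.rpow_def_of_pos (by positivity), mul_comm]
  rw [hpi, hpow, ← mul_assoc, ← Complex.ofReal_mul, ← Real.exp_add]
  simp only [neg_add_cancel, Real.exp_zero, Complex.ofReal_one, one_mul, Complex.I_sq]
  congr 1
  ring

theorem map_linearEquiv_withDensity {E : Type*} [NormedAddCommGroup E] [NormedSpace ℝ E]
    [FiniteDimensional ℝ E] [MeasurableSpace E] [BorelSpace E] (μ : Measure E)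
    [μ.IsAddHaarMeasure] (f : E →ₗ[ℝ] E) (hf : LinearMap.det f ≠ 0) {g : E → ℝ≥0∞}
    (hg : Measurable g) :
    (μ.withDensity fun x => g (f x)).map f =
      μ.withDensity fun x => ENNReal.ofReal |(LinearMap.det f)⁻¹| * g x := by
  have hfm : Measurable f := f.continuous_of_finiteDimensional.measurable
  refine Measure.ext_of_lintegral _ fun F hF => ?_
  rw [lintegral_map hF hfm,
      lintegral_withDensity_eq_lintegral_mul μ (f := fun x => g (f x)) (hg.comp hfm)
      (g := fun x => F (f x)) (hF.comp hfm),
    lintegral_withDensity_eq_lintegral_mul _ (by fun_prop) hF]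
  have h := lintegral_map (μ := μ) (hg.mul hF) hfm
  rw [Measure.map_linearMap_addHaar_eq_smul_addHaar μ hf, lintegral_smul_measure] at h
  simp only [Pi.mul_apply, smul_eq_mul] at h ⊢
  rw [← h, ← lintegral_const_mul _ (by fun_prop)]
  simp only [mul_assoc]

/-- The law is the image of the standard Gaussian under `T = √S`. Changing variables turns `‖x‖²`
into the quadratic form of `S⁻¹` and produces the factor `|det T|⁻¹ = (det S)^(-1/2)`. -/
theorem multivariateGaussian_eq_withDensity {S : Matrix ι ι ℝ} (hS : S.PosDef) :
    multivariateGaussian 0 S =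
      volume.withDensity fun x => ENNReal.ofReal (Real.exp (gaussLogDensity S x)) := by
  set T := CFC.sqrt S with hT
  have hTT : T * T = S := CFC.sqrt_mul_sqrt_self S hS.posSemidef.nonneg
  have hTdet : T.det * T.det = S.det := by rw [← det_mul, hTT]
  have hTd : T.det ≠ 0 := by
    intro h
    rw [h, zero_mul] at hTdet
    exact hS.det_pos.ne hTdet
  have hTsymm : Tᵀ = T := by
    have h : IsSelfAdjoint T := (CFC.sqrt_nonneg S).isSelfAdjoint
    simpa [IsSelfAdjoint, star_eq_conjTranspose, conjTranspose_eq_transpose_of_trivial] using h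
  set f : EuclideanSpace ℝ ι →ₗ[ℝ] EuclideanSpace ℝ ι := (toEuclideanCLM (𝕜 := ℝ) T).toLinearMap
    with hf
  have hfapp (x : EuclideanSpace ℝ ι) : (f x).ofLp = T *ᵥ x.ofLp := by
    simp [hf]
  have hfdet : LinearMap.det f = T.det := by
    rw [hf, coe_toEuclideanCLM_eq_toEuclideanLin]
    exact LinearMap.det_toLpLin 2 T
  have hquad (x : EuclideanSpace ℝ ι) : (f x).ofLp ⬝ᵥ S⁻¹ *ᵥ (f x).ofLp = ‖x‖ ^ 2 := by
    have : T * S⁻¹ * T = 1 := by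
      rw [← hTT, Matrix.mul_inv_rev, ← mul_assoc, mul_nonsing_inv _ (isUnit_iff_ne_zero.2 hTd),
          one_mul,
        nonsing_inv_mul _ (isUnit_iff_ne_zero.2 hTd)]
    nth_rewrite 1 [hfapp, ← hTsymm]
    rw [hfapp, mulVec_transpose, ← dotProduct_mulVec, mulVec_mulVec, mulVec_mulVec,
      this, one_mulVec, EuclideanSpace.real_norm_sq_eq]
    simp [dotProduct, sq]
  -- This `g` is chosen so that `g ∘ f` is the standard Gaussian density.
  have h := map_linearEquiv_withDensity (volume : Measure (EuclideanSpace ℝ ι)) f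
    (by rw [hfdet]; exact hTd) (g := fun x => ENNReal.ofReal
      (Real.exp (-(Fintype.card ι / 2 * Real.log (2 * Real.pi)) -
        1 / 2 * (x.ofLp ⬝ᵥ S⁻¹ *ᵥ x.ofLp)))) (by
      have h : Continuous fun x : EuclideanSpace ℝ ι => x.ofLp ⬝ᵥ S⁻¹ *ᵥ x.ofLp := by fun_prop
      have := h.measurable
      fun_prop)
  simp only [hquad, ← stdGaussian_eq_withDensity] at h
  simp only [multivariateGaussian, zero_add]
  refine h.trans ?_
  congr 1
  ext x
  rw [← ENNReal.ofReal_mul (abs_nonneg _), hfdet]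
  congr 1
  have : |T.det⁻¹| = Real.exp (-(1 / 2 * Real.log S.det)) := by
    rw [abs_inv, ← hTdet, Real.log_mul hTd hTd, ← Real.log_abs, Real.exp_neg,
      show 1 / 2 * (Real.log |T.det| + Real.log |T.det|) = Real.log |T.det| by ring,
      Real.exp_log (abs_pos.2 hTd)]
  rw [this, ← Real.exp_add, gaussLogDensity]
  congr 1
  ring

/-- The density is everywhere positive. This lets statements valid almost everywhere for a Gaussian
marginal pass to any law with a density. -/
theorem volume_absolutelyContinuous_multivariateGaussian (m : EuclideanSpace ℝ ι)
    {S : Matrix ι ι ℝ} (hS : S.PosDef) : volume ≪ multivariateGaussian m S := by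
  have h0 : (volume : Measure (EuclideanSpace ℝ ι)) ≪ multivariateGaussian 0 S := by
    rw [multivariateGaussian_eq_withDensity hS]
    exact withDensity_absolutelyContinuous' (by fun_prop)
      (Filter.Eventually.of_forall fun x => by simp [Real.exp_pos])
  have h := h0.map (measurable_const_add m)
  rw [map_add_left_eq_self] at h
  have hm : multivariateGaussian m S = (multivariateGaussian 0 S).map (m + ·) := by
    simp only [multivariateGaussian]
    rw [Measure.map_map (by fun_prop) (by fun_prop)]
    simp [Function.comp_def]
  rw [hm]
  exact h

end GaussianDensity

/-! ### Schur complements and the regression decomposition of a Gaussian pair. -/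

section Regression

open Matrix Module
open scoped RealInnerProductSpace MatrixOrder

variable {ι κ : Type*} [Fintype ι] [DecidableEq ι] [Fintype κ] [DecidableEq κ]

/-- The Schur complement of the upper left block, which is the conditional covariance of the second
component of a Gaussian pair given the first one. -/
def schurComplement (Γ : Matrix (κ ⊕ ι) (κ ⊕ ι) ℝ) : Matrix ι ι ℝ :=
  Γ.toBlocks₂₂ - Γ.toBlocks₂₁ * Γ.toBlocks₁₁⁻¹ * Γ.toBlocks₁₂

/-- The affine regression function of the second component of a pair with mean `m` and covariance
`Γ` on the first one. -/
def regression (m : EuclideanSpace ℝ (κ ⊕ ι)) (Γ : Matrix (κ ⊕ ι) (κ ⊕ ι) ℝ)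
    (y : EuclideanSpace ℝ κ) : EuclideanSpace ℝ ι :=
  WithLp.toLp 2 ((fun i => m (Sum.inr i)) +
    (Γ.toBlocks₂₁ * Γ.toBlocks₁₁⁻¹) *ᵥ fun k => y k - m (Sum.inl k))

@[fun_prop]
theorem measurable_regression {ι κ : Type*} [Fintype ι] [Fintype κ] [DecidableEq κ]
    (m : EuclideanSpace ℝ (κ ⊕ ι)) (Γ : Matrix (κ ⊕ ι) (κ ⊕ ι) ℝ) :
    Measurable (regression m Γ) := by
  have h : Continuous (regression m Γ) := by
    unfold regression
    fun_prop
  exact h.measurable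

theorem posDef_toBlocks₁₁ {ι κ : Type*} {Γ : Matrix (κ ⊕ ι) (κ ⊕ ι) ℝ} (hΓ : Γ.PosDef) :
    Γ.toBlocks₁₁.PosDef :=
  hΓ.submatrix Sum.inl_injective

theorem toBlocks₂₁_eq_conjTranspose {ι κ : Type*} {Γ : Matrix (κ ⊕ ι) (κ ⊕ ι) ℝ}
    (hΓ : Γ.IsHermitian) :
    Γ.toBlocks₂₁ = Γ.toBlocks₁₂ᴴ := by
  ext i j
  exact (hΓ.apply (Sum.inr i) (Sum.inl j)).symm

/-- Completing the square in `x`. -/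
theorem dotProduct_mulVec_eq_add_schurComplement {ι κ : Type*} [Fintype ι] [Fintype κ]
    [DecidableEq κ] {Γ : Matrix (κ ⊕ ι) (κ ⊕ ι) ℝ} (hΓ : Γ.PosDef)
    (x : κ → ℝ) (y : ι → ℝ) :
    Sum.elim x y ⬝ᵥ Γ *ᵥ Sum.elim x y =
      (x + (Γ.toBlocks₂₁ * Γ.toBlocks₁₁⁻¹)ᵀ *ᵥ y) ⬝ᵥ
          Γ.toBlocks₁₁ *ᵥ (x + (Γ.toBlocks₂₁ * Γ.toBlocks₁₁⁻¹)ᵀ *ᵥ y) +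
        y ⬝ᵥ schurComplement Γ *ᵥ y := by
  have h11 := posDef_toBlocks₁₁ hΓ
  have : Invertible Γ.toBlocks₁₁ := h11.isUnit.invertible
  have h := schur_complement_eq₁₁ Γ.toBlocks₁₂ Γ.toBlocks₂₂ x y h11.isHermitian
  rw [← toBlocks₂₁_eq_conjTranspose hΓ.isHermitian, fromBlocks_toBlocks] at h
  have hT : (Γ.toBlocks₂₁ * Γ.toBlocks₁₁⁻¹)ᵀ = Γ.toBlocks₁₁⁻¹ * Γ.toBlocks₁₂ := by
    rw [← conjTranspose_eq_transpose_of_trivial, conjTranspose_mul,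
      toBlocks₂₁_eq_conjTranspose hΓ.isHermitian, conjTranspose_conjTranspose,
      h11.isHermitian.inv.eq]
  simpa only [star_trivial, ← dotProduct_mulVec, schurComplement, hT] using h

theorem det_eq_mul_det_schurComplement {Γ : Matrix (κ ⊕ ι) (κ ⊕ ι) ℝ} (hΓ : Γ.PosDef) :
    Γ.det = Γ.toBlocks₁₁.det * (schurComplement Γ).det := by
  have : Invertible Γ.toBlocks₁₁ := (posDef_toBlocks₁₁ hΓ).isUnit.invertible
  conv_lhs => rw [← fromBlocks_toBlocks Γ]
  rw [det_fromBlocks₁₁, invOf_eq_nonsing_inv, schurComplement]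

/-- Semidefiniteness is the block criterion; the determinant factorization excludes a zero
determinant. -/
theorem posDef_schurComplement {Γ : Matrix (κ ⊕ ι) (κ ⊕ ι) ℝ} (hΓ : Γ.PosDef) :
    (schurComplement Γ).PosDef := by
  have h11 := posDef_toBlocks₁₁ hΓ
  have : Invertible Γ.toBlocks₁₁ := h11.isUnit.invertible
  have h21 := toBlocks₂₁_eq_conjTranspose hΓ.isHermitian
  refine PosSemidef.posDef_iff_det_ne_zero ?_ |>.2 ?_
  · have h := hΓ.posSemidef
    rw [← fromBlocks_toBlocks Γ, h21, PosDef.fromBlocks₁₁ _ _ h11] at h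
    rwa [schurComplement, h21]
  · intro h0
    have h := det_eq_mul_det_schurComplement hΓ
    rw [h0, mul_zero] at h
    exact hΓ.det_pos.ne' h

/-- A Gaussian pair is the image of an independent pair consisting of its first component and of
the regression residual. -/
theorem multivariateGaussian_eq_map_prod (m : EuclideanSpace ℝ (κ ⊕ ι))
    {Γ : Matrix (κ ⊕ ι) (κ ⊕ ι) ℝ} (hΓ : Γ.PosDef) :
    multivariateGaussian m Γ =
      ((multivariateGaussian (WithLp.toLp 2 fun k => m (Sum.inl k)) Γ.toBlocks₁₁).prod
        (multivariateGaussian 0 (schurComplement Γ))).map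
          fun p => stack p.1 (p.2 + regression m Γ p.1) := by
  set m₁ : EuclideanSpace ℝ κ := WithLp.toLp 2 fun k => m (Sum.inl k) with hm₁
  set A := Γ.toBlocks₂₁ * Γ.toBlocks₁₁⁻¹ with hA
  have hmeas : Measurable fun p : EuclideanSpace ℝ κ × EuclideanSpace ℝ ι =>
      stack p.1 (p.2 + regression m Γ p.1) := by
    have h : Continuous fun p : EuclideanSpace ℝ κ × EuclideanSpace ℝ ι =>
        stack p.1 (p.2 + regression m Γ p.1) := by
      unfold stack regression
      refine (PiLp.continuous_toLp 2 _).comp (continuous_pi fun s => ?_)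
      cases s <;> simp <;> fun_prop
    exact h.measurable
  have : IsProbabilityMeasure (((multivariateGaussian m₁ Γ.toBlocks₁₁).prod
        (multivariateGaussian 0 (schurComplement Γ))).map
          fun p => stack p.1 (p.2 + regression m Γ p.1)) :=
    Measure.isProbabilityMeasure_map hmeas.aemeasurable
  apply Measure.ext_of_charFun
  ext t
  set t₁ : κ → ℝ := fun k => t (Sum.inl k) with ht₁
  set t₂ : ι → ℝ := fun i => t (Sum.inr i) with ht₂
  have ht : t.ofLp = Sum.elim t₁ t₂ := by
    ext s
    cases s <;> rfl
  set m₂ : ι → ℝ := fun i => m (Sum.inr i) with hm₂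
  have hm : m.ofLp = Sum.elim m₁.ofLp m₂ := by
    ext s
    cases s <;> rfl
  set c : ℝ := t₂ ⬝ᵥ m₂ - t₂ ⬝ᵥ A *ᵥ m₁.ofLp with hc
  -- The pairing with `t` separates into a term in `p.1`, a term in `p.2` and a constant, so the
  -- characteristic function factorizes.
  have hin (p : EuclideanSpace ℝ κ × EuclideanSpace ℝ ι) :
      ⟪stack p.1 (p.2 + regression m Γ p.1), t⟫ =
        ⟪p.1, WithLp.toLp 2 (t₁ + Aᵀ *ᵥ t₂)⟫ + ⟪p.2, WithLp.toLp 2 t₂⟫ + c := by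
    simp only [EuclideanSpace.inner_eq_star_dotProduct, star_trivial, ht, stack, regression]
    have e : (fun k => p.1 k - m (Sum.inl k)) = p.1.ofLp - m₁.ofLp := rfl
    rw [e, ← hA, ← hm₂]
    change Sum.elim t₁ t₂ ⬝ᵥ Sum.elim p.1.ofLp (p.2.ofLp + (m₂ + A *ᵥ (p.1.ofLp - m₁.ofLp))) = _
    rw [sumElim_dotProduct_sumElim, dotProduct_add, dotProduct_add, mulVec_sub, dotProduct_sub,
      add_dotProduct, mulVec_transpose, ← dotProduct_mulVec, hc]
    ring
  rw [charFun_multivariateGaussian hΓ.posSemidef, charFun_apply,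
    integral_map hmeas.aemeasurable (by fun_prop)]
  have hpt (p : EuclideanSpace ℝ κ × EuclideanSpace ℝ ι) :
      Complex.exp (⟪stack p.1 (p.2 + regression m Γ p.1), t⟫ * Complex.I) =
        (Complex.exp (⟪p.1, WithLp.toLp 2 (t₁ + Aᵀ *ᵥ t₂)⟫ * Complex.I) *
          Complex.exp (⟪p.2, WithLp.toLp 2 t₂⟫ * Complex.I)) * Complex.exp (c * Complex.I) := by
    rw [hin, ← Complex.exp_add, ← Complex.exp_add]
    push_cast
    ring_nf
  rw [integral_congr_ae (Filter.Eventually.of_forall hpt), integral_mul_const,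
    integral_prod_mul (fun y => Complex.exp (⟪y, WithLp.toLp 2 (t₁ + Aᵀ *ᵥ t₂)⟫ * Complex.I))
      (fun z => Complex.exp (⟪z, WithLp.toLp 2 t₂⟫ * Complex.I)), ← charFun_apply,
    ← charFun_apply, charFun_multivariateGaussian (posDef_toBlocks₁₁ hΓ).posSemidef,
    charFun_multivariateGaussian (posDef_schurComplement hΓ).posSemidef, ← Complex.exp_add,
    ← Complex.exp_add]
  congr 1
  rw [ht, dotProduct_mulVec_eq_add_schurComplement hΓ, ← hA]
  have hmean : ⟪t, m⟫ = ⟪(WithLp.toLp 2 (t₁ + Aᵀ *ᵥ t₂) : EuclideanSpace ℝ κ), m₁⟫ + c := by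
    simp only [EuclideanSpace.inner_eq_star_dotProduct, star_trivial, ht, hm]
    rw [sumElim_dotProduct_sumElim, dotProduct_add, mulVec_transpose,
      dotProduct_comm m₁.ofLp (t₂ ᵥ* A), ← dotProduct_mulVec, hc, dotProduct_comm m₁.ofLp,
          dotProduct_comm m₂]
    ring
  rw [hmean, inner_zero_right]
  push_cast
  ring

end Regression

/-! ### Conditional divergence as a divergence from a product measure. -/

section CondDivergence

open Matrix

variable {Ω ι κ : Type*} [MeasurableSpace Ω] [Fintype ι] [DecidableEq ι] [Fintype κ]
  [DecidableEq κ]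

theorem gaussianPairLaw_eq_map_prod (Y : Ω → EuclideanSpace ℝ κ) (X : Ω → EuclideanSpace ℝ ι)
    (P : Measure Ω) (hΓ : (covMatrix (fun ω => stack (Y ω) (X ω)) P).PosDef) :
    gaussianPairLaw Y X P =
      ((multivariateGaussian
          (WithLp.toLp 2 fun k => meanVec (fun ω => stack (Y ω) (X ω)) P (Sum.inl k))
          (covMatrix (fun ω => stack (Y ω) (X ω)) P).toBlocks₁₁).prod
        (multivariateGaussian 0
          (schurComplement (covMatrix (fun ω => stack (Y ω) (X ω)) P)))).map
        fun p => (p.1, p.2 + regression (meanVec (fun ω => stack (Y ω) (X ω)) P)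
          (covMatrix (fun ω => stack (Y ω) (X ω)) P) p.1) := by
  rw [gaussianPairLaw]
  conv_lhs => rw [multivariateGaussian_eq_map_prod _ hΓ]
  rw [Measure.map_map]
  · rfl
  · fun_prop
  · have h : Continuous fun p : EuclideanSpace ℝ κ × EuclideanSpace ℝ ι =>
        stack p.1 (p.2 + regression (meanVec (fun ω => stack (Y ω) (X ω)) P)
          (covMatrix (fun ω => stack (Y ω) (X ω)) P) p.1) := by
      unfold stack regression
      refine (PiLp.continuous_toLp 2 _).comp (continuous_pi fun s => ?_)
      cases s <;> simp <;> fun_prop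
    exact h.measurable

/-- The conditional divergence in terms of the regression residual. -/
theorem condDivergence_eq_klDiv_residual {Y : Ω → EuclideanSpace ℝ κ} {X : Ω → EuclideanSpace ℝ ι}
    (hY : Measurable Y) (hX : Measurable X) (P : Measure Ω) [IsProbabilityMeasure P]
    (hΓ : (covMatrix (fun ω => stack (Y ω) (X ω)) P).PosDef) (hac : P.map Y ≪ volume) :
    condDivergence X Y P = InformationTheory.klDiv
      (P.map fun ω => (Y ω, X ω - regression (meanVec (fun ω => stack (Y ω) (X ω)) P)
        (covMatrix (fun ω => stack (Y ω) (X ω)) P) (Y ω)))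
      ((P.map Y).prod (multivariateGaussian 0
        (schurComplement (covMatrix (fun ω => stack (Y ω) (X ω)) P)))) := by
  set b := regression (meanVec (fun ω => stack (Y ω) (X ω)) P)
    (covMatrix (fun ω => stack (Y ω) (X ω)) P) with hb
  have hbm : Measurable b := measurable_regression _ _
  set ν := multivariateGaussian 0 (schurComplement (covMatrix (fun ω => stack (Y ω) (X ω)) P))
  set γ := multivariateGaussian
    (WithLp.toLp 2 fun k => meanVec (fun ω => stack (Y ω) (X ω)) P (Sum.inl k))
    (covMatrix (fun ω => stack (Y ω) (X ω)) P).toBlocks₁₁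
  have hshear : Measurable fun p : EuclideanSpace ℝ κ × EuclideanSpace ℝ ι =>
    (p.1, p.2 + b p.1) := by fun_prop
  -- An explicit conditional law for the Gaussian pair: `ν` translated by the regression value `b
  -- y`.
  let η : Kernel (EuclideanSpace ℝ κ) (EuclideanSpace ℝ ι) :=
    (Kernel.id ×ₖ Kernel.const _ ν).map fun p => p.2 + b p.1
  have hη : IsMarkovKernel η := Kernel.IsMarkovKernel.map _ (by fun_prop)
  have hcomp (μ : Measure (EuclideanSpace ℝ κ)) [IsProbabilityMeasure μ] :
      μ.compProd η = (μ.prod ν).map fun p => (p.1, p.2 + b p.1) := by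
    refine Measure.ext_of_lintegral _ fun F hF => ?_
    rw [Measure.lintegral_compProd hF, lintegral_map hF hshear, lintegral_prod _ (by fun_prop)]
    refine lintegral_congr fun y => ?_
    simp only [η]
    rw [Kernel.lintegral_map _ (by fun_prop) _ (by fun_prop),
        Kernel.lintegral_id_prod (by fun_prop)]
    simp
  have hpair : gaussianPairLaw Y X P = γ.compProd η := by
    rw [hcomp, gaussianPairLaw_eq_map_prod Y X P hΓ]
  have hPY : IsProbabilityMeasure (P.map Y) := Measure.isProbabilityMeasure_map hY.aemeasurable
  -- Conditional kernels are unique only up to `γ`-null sets; the density of `Y` makes these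
  -- `P_Y`-null.
  have hae : (gaussianPairLaw Y X P).condKernel =ᵐ[P.map Y] η := by
    have hac' : P.map Y ≪ γ := hac.trans
      (volume_absolutelyContinuous_multivariateGaussian _ (posDef_toBlocks₁₁ hΓ))
    refine hac'.ae_eq ?_
    simp_rw [hpair]
    exact condKernel_compProd γ η
  rw [condDivergence, compProd_map_condDistrib hX.aemeasurable, Measure.compProd_congr hae, hcomp,
    ← klDiv_map_of_leftInverse (P.map fun ω => (Y ω, X ω - b (Y ω))) ((P.map Y).prod ν) hshear
      (g := fun p => (p.1, p.2 - b p.1)) (by fun_prop) (fun p => by simp),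
    Measure.map_map hshear (by fun_prop)]
  simp [Function.comp_def]

end CondDivergence

/-! ### Second moments under affine maps and independent sums. -/

section AffineMoments

open Matrix

variable {Ω ι κ : Type*} [MeasurableSpace Ω] [Fintype ι] [Fintype κ] {P : Measure Ω}
  {Z : Ω → EuclideanSpace ℝ ι}

theorem memLp_mulVec_apply {κ : Type*} (hZ : ∀ i, MemLp (fun ω => Z ω i) 2 P) (A : Matrix κ ι ℝ)
    (k : κ) :
    MemLp (fun ω => (A *ᵥ (Z ω).ofLp) k) 2 P :=
  memLp_finsetSum _ fun i _ => (hZ i).const_mul (A k i)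

theorem covMatrix_mulVec_add {κ : Type*} [IsProbabilityMeasure P]
    (hZ : ∀ i, MemLp (fun ω => Z ω i) 2 P)
    (A : Matrix κ ι ℝ) (b : κ → ℝ) :
    covMatrix (fun ω => (WithLp.toLp 2 (A *ᵥ (Z ω).ofLp + b) : EuclideanSpace ℝ κ)) P =
      A * covMatrix Z P * Aᵀ := by
  ext k l
  have hL (k : κ) := memLp_mulVec_apply hZ A k
  simp only [covMatrix, of_apply, Pi.add_apply]
  rw [covariance_add_const_left ((hL k).integrable (by norm_num)),
    covariance_add_const_right ((hL l).integrable (by norm_num))]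
  simp only [mulVec, dotProduct]
  rw [covariance_fun_sum_fun_sum (fun i => (hZ i).const_mul _) (fun i => (hZ i).const_mul _)]
  simp only [covariance_const_mul_left, covariance_const_mul_right, mul_apply, transpose_apply,
    of_apply, Finset.sum_mul]
  rw [Finset.sum_comm]
  refine Finset.sum_congr rfl fun i _ => Finset.sum_congr rfl fun j _ => ?_
  ring

theorem covMatrix_add {ι : Type*} {Z : Ω → EuclideanSpace ℝ ι} [IsProbabilityMeasure P]
    {Z' : Ω → EuclideanSpace ℝ ι}
    (hZ : ∀ i, MemLp (fun ω => Z ω i) 2 P) (hZ' : ∀ i, MemLp (fun ω => Z' ω i) 2 P)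
    (h : IndepFun Z Z' P) :
    covMatrix (fun ω => Z ω + Z' ω) P = covMatrix Z P + covMatrix Z' P := by
  have hi (i j : ι) : cov[fun ω => Z ω i, fun ω => Z' ω j; P] = 0 :=
    (h.comp (φ := fun z : EuclideanSpace ℝ ι => z i) (ψ := fun z : EuclideanSpace ℝ ι => z j)
      (by fun_prop) (by fun_prop)).covariance_eq_zero (hZ i) (hZ' j)
  ext i j
  simp only [covMatrix, of_apply, Matrix.add_apply, PiLp.add_apply]
  have e1 := covariance_add_left (hZ i) (hZ' i) ((hZ j).add (hZ' j))
  have e2 := covariance_add_right (hZ i) (hZ j) (hZ' j)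
  have e3 := covariance_add_right (hZ' i) (hZ j) (hZ' j)
  rw [e2, e3, hi i j, covariance_comm (fun ω => Z' ω i) (fun ω => Z ω j), hi j i] at e1
  simpa [Pi.add_def] using e1

/-- The quadratic form at `x` is the variance of `xᵀZ`, read off from the `1 × 1` covariance of the
image under the row matrix `x`. -/
theorem posSemidef_covMatrix [IsProbabilityMeasure P] (hZ : ∀ i, MemLp (fun ω => Z ω i) 2 P) :
    (covMatrix Z P).PosSemidef := by
  refine PosSemidef.of_dotProduct_mulVec_nonneg (covMatrix_isHermitian Z P) fun x => ?_
  have h := congrFun (congrFun (covMatrix_mulVec_add hZ (replicateRow Unit x) 0) ()) ()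
  have h2 : ((replicateRow Unit x) * covMatrix Z P * (replicateRow Unit x)ᵀ) () () =
      x ⬝ᵥ covMatrix Z P *ᵥ x := by
    rw [dotProduct_mulVec]
    simp [mul_apply, vecMul, dotProduct, replicateRow]
  rw [star_trivial, ← h2, ← h]
  simp only [covMatrix, of_apply]
  rw [covariance_self]
  · exact variance_nonneg _ _
  · exact ((memLp_mulVec_apply hZ (replicateRow Unit x) ()).add (memLp_const 0)).aemeasurable

variable [DecidableEq ι]

theorem integrable_gaussLogDensity [IsProbabilityMeasure P]
    (hZ : ∀ i, MemLp (fun ω => Z ω i) 2 P) (C : Matrix ι ι ℝ) :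
    Integrable (fun ω => gaussLogDensity C (Z ω)) P := by
  unfold gaussLogDensity
  refine (integrable_const _).sub (Integrable.const_mul ?_ _)
  exact integrable_finsetSum _ fun i _ => (hZ i).integrable_mul (memLp_mulVec_apply hZ C⁻¹ i)

/-- The expected Gaussian log-density of a centred random vector with the matching covariance. -/
theorem integral_gaussLogDensity [IsProbabilityMeasure P]
    (hZ : ∀ i, MemLp (fun ω => Z ω i) 2 P) (hmean : ∀ i, ∫ ω, Z ω i ∂P = 0)
    (hC : (covMatrix Z P).PosDef) :
    ∫ ω, gaussLogDensity (covMatrix Z P) (Z ω) ∂P =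
      -(Fintype.card ι / 2 * Real.log (2 * Real.pi)) - 1 / 2 * Real.log (covMatrix Z P).det -
        1 / 2 * Fintype.card ι := by
  set C := covMatrix Z P with hCdef
  have hcov (i j : ι) : ∫ ω, Z ω i * Z ω j ∂P = C i j := by
    simp [hCdef, covMatrix, covariance, hmean]
  have hterm (i : ι) : Integrable (fun ω => Z ω i * (C⁻¹ *ᵥ (Z ω).ofLp) i) P :=
    (hZ i).integrable_mul (memLp_mulVec_apply hZ C⁻¹ i)
  -- The expected quadratic form is the trace of `C⁻¹ * C`, hence the dimension whatever the law of
  -- `Z`.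
  have hquad : ∫ ω, (Z ω).ofLp ⬝ᵥ C⁻¹ *ᵥ (Z ω).ofLp ∂P = Fintype.card ι := by
    simp only [dotProduct]
    rw [integral_finsetSum _ fun i _ => hterm i]
    have h1 (i : ι) : ∫ ω, Z ω i * (C⁻¹ *ᵥ (Z ω).ofLp) i ∂P = (C⁻¹ * C) i i := by
      simp only [mulVec, dotProduct, Finset.mul_sum, mul_apply]
      rw [integral_finsetSum]
      · refine Finset.sum_congr rfl fun j _ => ?_
        rw [← hcov j i, ← integral_const_mul]
        congr 1
        ext ω
        ring
      · intro j _
        exact (hZ i).integrable_mul ((hZ j).const_mul _)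
    simp_rw [h1]
    rw [nonsing_inv_mul _ (isUnit_iff_ne_zero.2 hC.det_pos.ne')]
    simp
  have hint : Integrable (fun ω => (Z ω).ofLp ⬝ᵥ C⁻¹ *ᵥ (Z ω).ofLp) P :=
    integrable_finsetSum _ fun i _ => hterm i
  unfold gaussLogDensity
  rw [integral_sub (integrable_const _) (hint.const_mul _), integral_const_mul, hquad]
  simp

end AffineMoments

/-! ### The regression residual: mean and covariance. -/

section Residual

open Matrix

variable {Ω ι κ : Type*} [MeasurableSpace Ω] [Fintype ι] [Fintype κ] [DecidableEq κ]
  {P : Measure Ω} {Y : Ω → EuclideanSpace ℝ κ} {X : Ω → EuclideanSpace ℝ ι}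

/-- The residual of the affine regression of `X` on `Y`. -/
def residual (X : Ω → EuclideanSpace ℝ ι) (Y : Ω → EuclideanSpace ℝ κ) (P : Measure Ω) (ω : Ω) :
    EuclideanSpace ℝ ι :=
  X ω - regression (meanVec (fun ω => stack (Y ω) (X ω)) P)
    (covMatrix (fun ω => stack (Y ω) (X ω)) P) (Y ω)

theorem measurable_residual (hX : Measurable X) (hY : Measurable Y) :
    Measurable (residual X Y P) := by
  unfold residual
  fun_prop

theorem residual_apply {ι : Type*} {X : Ω → EuclideanSpace ℝ ι} {A : Matrix ι κ ℝ}
    (hA : (covMatrix (fun ω => stack (Y ω) (X ω)) P).toBlocks₂₁ *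
      (covMatrix (fun ω => stack (Y ω) (X ω)) P).toBlocks₁₁⁻¹ = A) (ω : Ω) (i : ι) :
    residual X Y P ω i =
      (X ω i - ∫ ω, X ω i ∂P) - ∑ k, A i k * (Y ω k - ∫ ω, Y ω k ∂P) := by
  simp only [residual, regression, hA]
  simp [meanVec, stack, mulVec, dotProduct]
  ring

variable [IsProbabilityMeasure P]

theorem memLp_residual {ι : Type*} {X : Ω → EuclideanSpace ℝ ι}
    (hX : ∀ i, MemLp (fun ω => X ω i) 2 P)
    (hY : ∀ k, MemLp (fun ω => Y ω k) 2 P) (i : ι) :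
    MemLp (fun ω => residual X Y P ω i) 2 P := by
  simp_rw [residual_apply rfl]
  exact ((hX i).sub (memLp_const _)).sub
    (memLp_finsetSum _ fun k _ => ((hY k).sub (memLp_const _)).const_mul _)

theorem integral_residual {ι : Type*} {X : Ω → EuclideanSpace ℝ ι}
    (hX : ∀ i, MemLp (fun ω => X ω i) 2 P)
    (hY : ∀ k, MemLp (fun ω => Y ω k) 2 P) (i : ι) : ∫ ω, residual X Y P ω i ∂P = 0 := by
  obtain ⟨A, hA⟩ : ∃ A, (covMatrix (fun ω => stack (Y ω) (X ω)) P).toBlocks₂₁ *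
      (covMatrix (fun ω => stack (Y ω) (X ω)) P).toBlocks₁₁⁻¹ = A := ⟨_, rfl⟩
  have hX1 := (hX i).integrable (by norm_num)
  have hY1 (k : κ) := (hY k).integrable (by norm_num)
  have hX0 : ∫ ω, (X ω i - ∫ ω, X ω i ∂P) ∂P = 0 := by
    rw [integral_sub hX1 (integrable_const _)]
    simp
  have hY0 (k : κ) : ∫ ω, (Y ω k - ∫ ω, Y ω k ∂P) ∂P = 0 := by
    rw [integral_sub (hY1 k) (integrable_const _)]
    simp
  have hX2 : Integrable (fun ω => X ω i - ∫ ω, X ω i ∂P) P := hX1.sub (integrable_const _)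
  have hYi (k : κ) : Integrable (fun ω => A i k * (Y ω k - ∫ ω, Y ω k ∂P)) P :=
    ((hY1 k).sub (integrable_const _)).const_mul _
  simp_rw [residual_apply hA]
  rw [integral_sub hX2 (integrable_finsetSum _ fun k _ => hYi k), hX0,
    integral_finsetSum _ fun k _ => hYi k]
  simp [integral_const_mul, hY0]

variable [DecidableEq ι]

/-- Up to a constant, the residual is the image of the stacked vector under the block row `(-A, 1)`.
-/
theorem covMatrix_residual (hX : ∀ i, MemLp (fun ω => X ω i) 2 P)
    (hY : ∀ k, MemLp (fun ω => Y ω k) 2 P)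
    (hΓ : (covMatrix (fun ω => stack (Y ω) (X ω)) P).PosDef) :
    covMatrix (residual X Y P) P =
      schurComplement (covMatrix (fun ω => stack (Y ω) (X ω)) P) := by
  set Γ := covMatrix (fun ω => stack (Y ω) (X ω)) P with hΓdef
  set A := Γ.toBlocks₂₁ * Γ.toBlocks₁₁⁻¹ with hA
  have hZ (s : κ ⊕ ι) : MemLp (fun ω => stack (Y ω) (X ω) s) 2 P := by
    cases s with
    | inl k => exact hY k
    | inr i => exact hX i
  set b : ι → ℝ := fun i => -(∫ ω, X ω i ∂P) + ∑ k, A i k * ∫ ω, Y ω k ∂P with hb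
  have hres : residual X Y P = fun ω =>
      WithLp.toLp 2 (fromCols (-A) 1 *ᵥ (stack (Y ω) (X ω)).ofLp + b) := by
    ext ω i
    rw [residual_apply hA.symm]
    simp only [stack, fromCols_mulVec_sumElim, neg_mulVec, one_mulVec, Pi.add_apply, Pi.neg_apply,
      mulVec, dotProduct, hb, mul_sub, Finset.sum_sub_distrib]
    ring
  rw [hres, covMatrix_mulVec_add hZ, ← hΓdef]
  have h11 := posDef_toBlocks₁₁ hΓ
  conv_lhs => rw [← fromBlocks_toBlocks Γ]
  -- The normal equations: they make the first block of `(-A, 1) * Γ` vanish, and its second block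
  -- is the Schur complement.
  have hA11 : A * Γ.toBlocks₁₁ = Γ.toBlocks₂₁ := by
    rw [hA, Matrix.mul_assoc, nonsing_inv_mul _ (isUnit_iff_ne_zero.2 h11.det_pos.ne'),
      Matrix.mul_one]
  rw [fromCols_mul_fromBlocks, transpose_fromCols, fromCols_mul_fromRows, Matrix.neg_mul,
    Matrix.neg_mul, hA11, Matrix.one_mul, Matrix.one_mul, neg_add_cancel, Matrix.zero_mul, zero_add,
    transpose_one, Matrix.mul_one, schurComplement, ← hA]
  abel

end Residual

/-! ### Additive noise: from divergences to the information bound. -/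

section AdditiveNoise

open Matrix

variable {Ω δ ι κ : Type*} [MeasurableSpace Ω] [MeasurableSpace δ] [Fintype ι] [DecidableEq ι]
  [Fintype κ] [DecidableEq κ] {P : Measure Ω} [IsProbabilityMeasure P] {S : Ω → δ}
  {Y₁ N₁ : Ω → EuclideanSpace ℝ κ} {Y₂ N₂ : Ω → EuclideanSpace ℝ ι}
  {h₁ : δ → EuclideanSpace ℝ κ} {h₂ : δ → EuclideanSpace ℝ ι}

/-- For independent `S` and `(N₁, N₂)`, the divergence of the regression residual of `h₂(S) + N₂`
on `h₁(S) + N₁`, conditionally on `S` as well, in terms of the conditional divergence of the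
noise. -/
theorem klDiv_residual_eq (hS : Measurable S) (hN₁ : Measurable N₁) (hN₂ : Measurable N₂)
    (hh₁ : Measurable h₁) (hh₂ : Measurable h₂)
    (hY₁ : Y₁ = fun ω => h₁ (S ω) + N₁ ω) (hY₂ : Y₂ = fun ω => h₂ (S ω) + N₂ ω)
    (hind : IndepFun S (fun ω => (N₁ ω, N₂ ω)) P)
    (hN₁2 : ∀ k, MemLp (fun ω => N₁ ω k) 2 P) (hN₂2 : ∀ i, MemLp (fun ω => N₂ ω i) 2 P)
    (hY₁2 : ∀ k, MemLp (fun ω => Y₁ ω k) 2 P) (hY₂2 : ∀ i, MemLp (fun ω => Y₂ ω i) 2 P)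
    (hN : (covMatrix (fun ω => stack (N₁ ω) (N₂ ω)) P).PosDef)
    (hY : (covMatrix (fun ω => stack (Y₁ ω) (Y₂ ω)) P).PosDef)
    (hac : P.map N₁ ≪ volume) (hfin : condDivergence N₂ N₁ P ≠ ∞) :
    InformationTheory.klDiv (P.map fun ω => ((S ω, Y₁ ω), residual Y₂ Y₁ P ω))
        ((P.map fun ω => (S ω, Y₁ ω)).prod (multivariateGaussian 0
          (schurComplement (covMatrix (fun ω => stack (Y₁ ω) (Y₂ ω)) P)))) ≠ ∞ ∧
    (InformationTheory.klDiv (P.map fun ω => ((S ω, Y₁ ω), residual Y₂ Y₁ P ω))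
        ((P.map fun ω => (S ω, Y₁ ω)).prod (multivariateGaussian 0
          (schurComplement (covMatrix (fun ω => stack (Y₁ ω) (Y₂ ω)) P))))).toReal =
      (condDivergence N₂ N₁ P).toReal +
        1 / 2 * (Real.log (schurComplement (covMatrix (fun ω => stack (Y₁ ω) (Y₂ ω)) P)).det -
          Real.log (schurComplement (covMatrix (fun ω => stack (N₁ ω) (N₂ ω)) P)).det) := by
  have hY₁m : Measurable Y₁ := by rw [hY₁]; fun_prop
  have hY₂m : Measurable Y₂ := by rw [hY₂]; fun_prop
  have hRN : Measurable (residual N₂ N₁ P) := measurable_residual hN₂ hN₁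
  have hRY : Measurable (residual Y₂ Y₁ P) := measurable_residual hY₂m hY₁m
  have hJ : condDivergence N₂ N₁ P = InformationTheory.klDiv
      (P.map fun ω => (N₁ ω, residual N₂ N₁ P ω)) ((P.map N₁).prod (multivariateGaussian 0
        (schurComplement (covMatrix (fun ω => stack (N₁ ω) (N₂ ω)) P)))) :=
    condDivergence_eq_klDiv_residual hN₁ hN₂ P hN hac
  have hcovN := covMatrix_residual hN₂2 hN₁2 hN
  have hcovY := covMatrix_residual hY₂2 hY₁2 hY
  have hCN := posDef_schurComplement hN
  have hCY := posDef_schurComplement hY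
  set CN := schurComplement (covMatrix (fun ω => stack (N₁ ω) (N₂ ω)) P)
  set CY := schurComplement (covMatrix (fun ω => stack (Y₁ ω) (Y₂ ω)) P)
  obtain ⟨rN, hrN, hrNres⟩ : ∃ r : EuclideanSpace ℝ κ → EuclideanSpace ℝ ι, Measurable r ∧
      ∀ ω, residual N₂ N₁ P ω = N₂ ω - r (N₁ ω) := ⟨_, measurable_regression _ _, fun _ => rfl⟩
  obtain ⟨rY, hrY, hrYres⟩ : ∃ r : EuclideanSpace ℝ κ → EuclideanSpace ℝ ι, Measurable r ∧
      ∀ ω, residual Y₂ Y₁ P ω = Y₂ ω - r (Y₁ ω) := ⟨_, measurable_regression _ _, fun _ => rfl⟩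
  set RN := residual N₂ N₁ P
  set RY := residual Y₂ Y₁ P
  -- The two residuals differ by a function of `(S, N₁)` alone, so passing from one to the other is
  -- a shift of the last component.
  set c : δ × EuclideanSpace ℝ κ → EuclideanSpace ℝ ι :=
    fun w => h₂ w.1 - rY (h₁ w.1 + w.2) + rN w.2 with hc
  have hcm : Measurable c := by fun_prop
  have hRYc (ω : Ω) : RY ω = RN ω + c (S ω, N₁ ω) := by
    simp only [hrYres, hrNres, hY₁, hY₂, hc]
    abel
  -- The log-ratio of the target reference, pulled back by the shift, to the noise reference.
  set φ : (δ × EuclideanSpace ℝ κ) × EuclideanSpace ℝ ι → ℝ :=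
    fun p => gaussLogDensity CY (p.2 + c p.1) - gaussLogDensity CN p.2 with hφdef
  have hφ : Measurable φ := by fun_prop
  set ξ := (P.map fun ω => (S ω, N₁ ω)).prod (multivariateGaussian 0 CN) with hξ
  have hSN : IsProbabilityMeasure (P.map fun ω => (S ω, N₁ ω)) :=
    Measure.isProbabilityMeasure_map (by fun_prop)
  have hSY : IsProbabilityMeasure (P.map fun ω => (S ω, Y₁ ω)) :=
    Measure.isProbabilityMeasure_map (by fun_prop)
  have hρ : IsProbabilityMeasure (P.map fun ω => ((S ω, N₁ ω), RN ω)) :=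
    Measure.isProbabilityMeasure_map (by fun_prop)
  have hPS : IsProbabilityMeasure (P.map S) := Measure.isProbabilityMeasure_map hS.aemeasurable
  have hPN : IsProbabilityMeasure (P.map N₁) := Measure.isProbabilityMeasure_map hN₁.aemeasurable
  have hPNR : IsProbabilityMeasure (P.map fun ω => (N₁ ω, RN ω)) :=
    Measure.isProbabilityMeasure_map (by fun_prop)
  have hshift := map_shift_withDensity_exp volume (P.map fun ω => (S ω, N₁ ω))
    (measurable_gaussLogDensity CY) (measurable_gaussLogDensity CN) hcm
    (h := fun w => (w.1, h₁ w.1 + w.2)) (by fun_prop)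
  rw [← multivariateGaussian_eq_withDensity hCN, ← multivariateGaussian_eq_withDensity hCY,
    Measure.map_map (by fun_prop) (by fun_prop)] at hshift
  have hmapSY : (P.map ((fun w : δ × EuclideanSpace ℝ κ => (w.1, h₁ w.1 + w.2)) ∘
      fun ω => (S ω, N₁ ω))) = P.map fun ω => (S ω, Y₁ ω) := by
    rw [hY₁]
    rfl
  rw [hmapSY, ← hξ] at hshift
  have hdens : IsProbabilityMeasure (ξ.withDensity fun p => ENNReal.ofReal (Real.exp (φ p))) := by
    have : IsProbabilityMeasure ((ξ.withDensity fun p => ENNReal.ofReal (Real.exp (φ p))).map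
        fun p => ((p.1.1, h₁ p.1.1 + p.1.2), p.2 + c p.1)) := by
      rw [hshift]
      infer_instance
    exact Measure.isProbabilityMeasure_of_map
      (fun p => ((p.1.1, h₁ p.1.1 + p.1.2), p.2 + c p.1))
  have hmapρ : (P.map fun ω => ((S ω, N₁ ω), RN ω)).map
      (fun p => ((p.1.1, h₁ p.1.1 + p.1.2), p.2 + c p.1)) =
        P.map fun ω => ((S ω, Y₁ ω), RY ω) := by
    rw [Measure.map_map (by fun_prop) (by fun_prop)]
    simp only [Function.comp_def, ← hRYc, hY₁]
  -- The map `((s, n), r) ↦ ((s, h₁ s + n), r + c (s, n))` is invertible, so the divergence can be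
  -- computed in noise coordinates.
  have hkl : InformationTheory.klDiv (P.map fun ω => ((S ω, Y₁ ω), RY ω))
      ((P.map fun ω => (S ω, Y₁ ω)).prod (multivariateGaussian 0 CY)) =
      InformationTheory.klDiv (P.map fun ω => ((S ω, N₁ ω), RN ω))
        (ξ.withDensity fun p => ENNReal.ofReal (Real.exp (φ p))) := by
    rw [← hshift, ← hmapρ]
    refine klDiv_map_of_leftInverse _ _ (by fun_prop)
      (g := fun p => ((p.1.1, p.1.2 - h₁ p.1.1), p.2 - c (p.1.1, p.1.2 - h₁ p.1.1)))
      (by fun_prop) fun p => ?_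
    simp
  have hindR : IndepFun S (fun ω => (N₁ ω, RN ω)) P := by
    have h := hind.comp (φ := id) (ψ := fun p : EuclideanSpace ℝ κ × EuclideanSpace ℝ ι =>
      (p.1, p.2 - rN p.1)) measurable_id (by fun_prop)
    simpa only [Function.comp_def, id, ← hrNres] using h
  have hindN : IndepFun S N₁ P := hind.comp (φ := id) measurable_id measurable_fst
  -- By independence `S` is a common factor of both measures and drops out.
  have hklN : InformationTheory.klDiv (P.map fun ω => ((S ω, N₁ ω), RN ω)) ξ =
      condDivergence N₂ N₁ P := by
    have hf : Measurable fun p : (δ × EuclideanSpace ℝ κ) × EuclideanSpace ℝ ι =>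
      ((p.1.2, p.2), p.1.1) := by fun_prop
    rw [hJ, ← klDiv_prod_const (P.map fun ω => (N₁ ω, RN ω)) _ (P.map S),
        ← klDiv_map_of_leftInverse _ ξ hf
      (g := fun p => ((p.2, p.1.1), p.1.2)) (by fun_prop) (fun _ => rfl)]
    congr 1
    · rw [Measure.map_map hf (by fun_prop),
        ← (indepFun_iff_map_prod_eq_prod_map_map (by fun_prop) hS.aemeasurable).1 hindR.symm]
      rfl
    · rw [hξ, (indepFun_iff_map_prod_eq_prod_map_map hS.aemeasurable hN₁.aemeasurable).1 hindN]
      have e : (fun p : (δ × EuclideanSpace ℝ κ) × EuclideanSpace ℝ ι => ((p.1.2, p.2), p.1.1)) =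
        Prod.swap ∘ (MeasurableEquiv.prodAssoc :
          (δ × EuclideanSpace ℝ κ) × EuclideanSpace ℝ ι ≃ᵐ _) := rfl
      rw [e, ← Measure.map_map measurable_swap MeasurableEquiv.prodAssoc.measurable,
        Measure.prodAssoc_prod, Measure.prod_swap]
  have hRN2 := memLp_residual hN₂2 hN₁2
  have hRY2 := memLp_residual hY₂2 hY₁2
  have hiN := integrable_gaussLogDensity hRN2 CN
  have hiY := integrable_gaussLogDensity hRY2 CY
  have hφeq : (φ ∘ fun ω => ((S ω, N₁ ω), RN ω)) = fun ω =>
      gaussLogDensity CY (RY ω) - gaussLogDensity CN (RN ω) := by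
    ext ω
    simp only [Function.comp_apply, hφdef, hRYc]
  have hφint : Integrable φ (P.map fun ω => ((S ω, N₁ ω), RN ω)) := by
    rw [integrable_map_measure hφ.aestronglyMeasurable (by fun_prop), hφeq]
    exact hiY.sub hiN
  -- Each quadratic term has expectation equal to the dimension, so these and the constants in `2π`
  -- cancel, leaving the log-determinants.
  have hφval : ∫ p, φ p ∂(P.map fun ω => ((S ω, N₁ ω), RN ω)) =
      1 / 2 * (Real.log CN.det - Real.log CY.det) := by
    have e1 := integral_gaussLogDensity hRN2 (integral_residual hN₂2 hN₁2) (hcovN ▸ hCN)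
    have e2 := integral_gaussLogDensity hRY2 (integral_residual hY₂2 hY₁2) (hcovY ▸ hCY)
    rw [hcovN] at e1
    rw [hcovY] at e2
    rw [integral_map (by fun_prop) hφ.aestronglyMeasurable]
    calc ∫ ω, φ ((S ω, N₁ ω), RN ω) ∂P
        = ∫ ω, (gaussLogDensity CY (RY ω) - gaussLogDensity CN (RN ω)) ∂P :=
          integral_congr_ae (Filter.Eventually.of_forall fun ω => congrFun hφeq ω)
      _ = _ := by
        rw [integral_sub hiY hiN, e1, e2]
        ring
  obtain ⟨hne, hreal⟩ := klDiv_withDensity_exp hφ (hklN ▸ hfin) hφint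
  rw [hkl]
  refine ⟨hne, ?_⟩
  rw [hreal, hklN, hφval]
  ring

/-- The information about a quantization of `S` which is lost by dropping `Y₂`, when the noise
is more Gaussian than the data. -/
theorem mutualInfo_pair_sub_le {σ : Type*} [MeasurableSpace σ] [StandardBorelSpace σ] [Nonempty σ]
    {q : δ → σ} (hq : Measurable q) (hS : Measurable S) (hN₁ : Measurable N₁)
    (hN₂ : Measurable N₂) (hh₁ : Measurable h₁) (hh₂ : Measurable h₂)
    (hY₁ : Y₁ = fun ω => h₁ (S ω) + N₁ ω) (hY₂ : Y₂ = fun ω => h₂ (S ω) + N₂ ω)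
    (hind : IndepFun S (fun ω => (N₁ ω, N₂ ω)) P)
    (hN₁2 : ∀ k, MemLp (fun ω => N₁ ω k) 2 P) (hN₂2 : ∀ i, MemLp (fun ω => N₂ ω i) 2 P)
    (hY₁2 : ∀ k, MemLp (fun ω => Y₁ ω k) 2 P) (hY₂2 : ∀ i, MemLp (fun ω => Y₂ ω i) 2 P)
    (hN : (covMatrix (fun ω => stack (N₁ ω) (N₂ ω)) P).PosDef)
    (hY : (covMatrix (fun ω => stack (Y₁ ω) (Y₂ ω)) P).PosDef)
    (hacN : P.map N₁ ≪ volume) (hacY : P.map Y₁ ≪ volume)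
    (hfin : condDivergence N₂ N₁ P ≠ ∞)
    (hle : condDivergence N₂ N₁ P ≤ condDivergence Y₂ Y₁ P) :
    (mutualInfo (fun ω => q (S ω)) (fun ω => (Y₁ ω, residual Y₂ Y₁ P ω)) P : EReal) -
        (mutualInfo (fun ω => q (S ω)) Y₁ P : EReal) ≤
      ((1 / 2 * (Real.log (schurComplement (covMatrix (fun ω => stack (Y₁ ω) (Y₂ ω)) P)).det -
        Real.log (schurComplement (covMatrix (fun ω => stack (N₁ ω) (N₂ ω)) P)).det) : ℝ) :
          EReal) := by
  have hY₁m : Measurable Y₁ := by rw [hY₁]; fun_prop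
  have hY₂m : Measurable Y₂ := by rw [hY₂]; fun_prop
  have hRY : Measurable (residual Y₂ Y₁ P) := measurable_residual hY₂m hY₁m
  obtain ⟨hD, hDreal⟩ := klDiv_residual_eq hS hN₁ hN₂ hh₁ hh₂ hY₁ hY₂ hind hN₁2 hN₂2 hY₁2 hY₂2 hN
    hY hacN hfin
  have hchain := mutualInfo_pair_add_klDiv P (T := fun ω => q (S ω)) (by fun_prop) hY₁m hRY
    (multivariateGaussian 0 (schurComplement (covMatrix (fun ω => stack (Y₁ ω) (Y₂ ω)) P)))
  have hquant := klDiv_quantization_le (P := P) hS hY₁m hRY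
    (multivariateGaussian 0 (schurComplement (covMatrix (fun ω => stack (Y₁ ω) (Y₂ ω)) P))) hq
  have hJY : condDivergence Y₂ Y₁ P = InformationTheory.klDiv
      (P.map fun ω => (Y₁ ω, residual Y₂ Y₁ P ω)) ((P.map Y₁).prod (multivariateGaussian 0
        (schurComplement (covMatrix (fun ω => stack (Y₁ ω) (Y₂ ω)) P)))) :=
    condDivergence_eq_klDiv_residual hY₁m hY₂m P hY hacY
  rw [← hJY] at hchain
  set a := mutualInfo (fun ω => q (S ω)) (fun ω => (Y₁ ω, residual Y₂ Y₁ P ω)) P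
  set b := mutualInfo (fun ω => q (S ω)) Y₁ P
  set D := InformationTheory.klDiv (P.map fun ω => ((S ω, Y₁ ω), residual Y₂ Y₁ P ω))
    ((P.map fun ω => (S ω, Y₁ ω)).prod (multivariateGaussian 0
      (schurComplement (covMatrix (fun ω => stack (Y₁ ω) (Y₂ ω)) P))))
  -- Replacing the divergence of `Y` by that of the noise leaves a finite term, which can then be
  -- subtracted.
  have hmain : a + condDivergence N₂ N₁ P ≤ b + D := calc
    a + condDivergence N₂ N₁ P ≤ a + condDivergence Y₂ Y₁ P := by gcongr
    _ ≤ b + D := by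
      rw [hchain]
      gcongr
  -- In `EReal`, `x - ⊤ = ⊥` for every `x`, so this case is trivial.
  by_cases hb : b = ∞
  · simp [hb]
  have ha : a ≠ ∞ := fun h => ENNReal.add_ne_top.2 ⟨hb, hD⟩ (by simpa [h] using hmain)
  have hreal := ENNReal.toReal_mono (ENNReal.add_ne_top.2 ⟨hb, hD⟩) hmain
  rw [ENNReal.toReal_add ha hfin, ENNReal.toReal_add hb hD, hDreal] at hreal
  rw [← EReal.coe_ennreal_toReal ha, ← EReal.coe_ennreal_toReal hb, ← EReal.coe_sub,
    EReal.coe_le_coe_iff]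
  linarith

end AdditiveNoise

/-! ### Weyl and Cauchy eigenvalue inequalities. -/

section Eigenvalues

open Matrix Module

variable {m n : ℕ}

/-- A linear map of rank at most `j` vanishes at a nonzero vector which is supported on the first
`j + 1` coordinates. -/
theorem exists_ne_zero_supported {V : Type*} [AddCommGroup V] [Module ℝ V]
    (L : (Fin n → ℝ) →ₗ[ℝ] V) (j : Fin n) (hL : finrank ℝ (LinearMap.range L) ≤ j) :
    ∃ u : Fin n → ℝ, u ≠ 0 ∧ (∀ i, j < i → u i = 0) ∧ L u = 0 := by
  let e : (Fin (j + 1) → ℝ) →ₗ[ℝ] (Fin n → ℝ) :=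
    Function.ExtendByZero.linearMap ℝ (Fin.castLE (Nat.succ_le_of_lt j.2))
  have he : Function.Injective e := by
    intro u v huv
    ext i
    have h := congrFun huv (Fin.castLE (Nat.succ_le_of_lt j.2) i)
    change Function.extend _ u (0 : Fin n → ℝ) _ = Function.extend _ v (0 : Fin n → ℝ) _ at h
    rwa [(Fin.castLE_injective _).extend_apply, (Fin.castLE_injective _).extend_apply] at h
  -- At most `j` independent conditions are imposed on `j + 1` coordinates.
  have hker : LinearMap.ker (L.rangeRestrict ∘ₗ e) ≠ ⊥ := by
    refine LinearMap.ker_ne_bot_of_finrank_lt ?_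
    rw [finrank_fin_fun]
    omega
  obtain ⟨u, hu, hu0⟩ := (Submodule.ne_bot_iff _).1 hker
  refine ⟨e u, fun h => hu0 (he (by rw [h, map_zero])), fun i hi => ?_, ?_⟩
  · refine Function.extend_apply' _ _ _ ?_
    rintro ⟨k, rfl⟩
    have hk := k.2
    rw [Fin.lt_def, Fin.val_castLE] at hi
    omega
  · have h := LinearMap.mem_ker.1 hu
    simpa [Subtype.ext_iff] using h

/-- For `u ≠ 0` the Rayleigh quotient is a weighted average of the `a i` with `i ≤ j`, all at least
`a j`. -/
theorem le_dotProduct_diagonal_mulVec {a : Fin n → ℝ} (ha : Antitone a) (j : Fin n) {u : Fin n → ℝ}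
    (hu : ∀ i, j < i → u i = 0) : a j * (u ⬝ᵥ u) ≤ u ⬝ᵥ diagonal a *ᵥ u := by
  simp only [dotProduct, mulVec_diagonal, Finset.mul_sum]
  refine Finset.sum_le_sum fun i _ => ?_
  rcases le_or_gt i j with h | h
  · nlinarith [ha h, mul_self_nonneg (u i)]
  · simp [hu i h]

theorem dotProduct_diagonal_mulVec_le {a : Fin n → ℝ} (ha : Antitone a) (j : Fin n) {u : Fin n → ℝ}
    (hu : ∀ i, i < j → u i = 0) : u ⬝ᵥ diagonal a *ᵥ u ≤ a j * (u ⬝ᵥ u) := by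
  simp only [dotProduct, mulVec_diagonal, Finset.mul_sum]
  refine Finset.sum_le_sum fun i _ => ?_
  rcases le_or_gt j i with h | h
  · nlinarith [ha h, mul_self_nonneg (u i)]
  · simp [hu i h]

theorem mulVec_dotProduct_mulVec_mulVec {ι κ : Type*} [Fintype ι] [Fintype κ] (Q : Matrix ι κ ℝ)
    (A : Matrix ι ι ℝ) (u : κ → ℝ) :
    (Q *ᵥ u) ⬝ᵥ A *ᵥ (Q *ᵥ u) = u ⬝ᵥ (Qᵀ * A * Q) *ᵥ u := by
  rw [Matrix.mul_assoc, ← mulVec_mulVec u Qᵀ, dotProduct_mulVec u Qᵀ, vecMul_transpose,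
      mulVec_mulVec]

theorem mulVec_dotProduct_mulVec_self {ι κ : Type*} [Fintype ι] [DecidableEq ι] [Fintype κ]
    [DecidableEq κ] {Q : Matrix ι κ ℝ} (hQ : Qᵀ * Q = 1) (u : κ → ℝ) : (Q *ᵥ u) ⬝ᵥ (Q *ᵥ u) = u ⬝ᵥ u
        := by
  have h := mulVec_dotProduct_mulVec_mulVec Q 1 u
  rwa [one_mulVec, Matrix.mul_one, hQ, one_mulVec] at h

theorem antitone_sortedEigenvalues {A : Matrix (Fin n) (Fin n) ℝ} (hA : A.IsHermitian) :
    Antitone (sortedEigenvalues hA) := fun _ _ h => hA.eigenvalues₀_antitone h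

/-- `IsHermitian.eigenvalues` reindexes the sorted `eigenvalues₀` along an arbitrary equivalence,
whence the permutation. -/
theorem exists_sortedEigenvalues_eq_comp {A : Matrix (Fin n) (Fin n) ℝ} (hA : A.IsHermitian) :
    ∃ σ : Equiv.Perm (Fin n), sortedEigenvalues hA = hA.eigenvalues ∘ σ := by
  refine ⟨(finCongr (Fintype.card_fin n).symm).trans
    (Fintype.equivOfCardEq (Fintype.card_fin _)), ?_⟩
  ext i
  simp [sortedEigenvalues, IsHermitian.eigenvalues]

/-- Orthogonal diagonalization with the eigenvalues in decreasing order. -/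
theorem exists_orthogonal_diagonalization {A : Matrix (Fin n) (Fin n) ℝ} (hA : A.IsHermitian) :
    ∃ U : Matrix (Fin n) (Fin n) ℝ, Uᵀ * U = 1 ∧ U * Uᵀ = 1 ∧
      Uᵀ * A * U = diagonal (sortedEigenvalues hA) := by
  obtain ⟨σ, hσ⟩ := exists_sortedEigenvalues_eq_comp hA
  set Q : Matrix (Fin n) (Fin n) ℝ := (hA.eigenvectorUnitary : Matrix (Fin n) (Fin n) ℝ)
  have hQ : Qᵀ * Q = 1 := by
    have h := (mem_unitaryGroup_iff' (A := Q)).1 hA.eigenvectorUnitary.2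
    rwa [star_eq_conjTranspose, conjTranspose_eq_transpose_of_trivial] at h
  have hAQ : Qᵀ * A * Q = diagonal hA.eigenvalues := by
    have h := hA.spectral_theorem
    rw [Unitary.conjStarAlgAut_apply, star_eq_conjTranspose,
      conjTranspose_eq_transpose_of_trivial] at h
    change A = Q * diagonal hA.eigenvalues * Qᵀ at h
    conv_lhs => rw [h]
    rw [Matrix.mul_assoc, Matrix.mul_assoc, Matrix.mul_assoc, hQ, Matrix.mul_one,
      ← Matrix.mul_assoc, hQ, Matrix.one_mul]
  refine ⟨Q.submatrix id σ, ?_, ?_, ?_⟩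
  · rw [transpose_submatrix, submatrix_mul _ _ _ _ _ Function.bijective_id |>.symm, hQ,
      submatrix_one_equiv]
  · rw [transpose_submatrix, submatrix_mul _ _ _ _ _ σ.bijective |>.symm, mul_eq_one_comm.1 hQ,
      submatrix_id_id]
  · have e : (Q.submatrix id σ)ᵀ * A * Q.submatrix id σ = (Qᵀ * A * Q).submatrix σ σ := rfl
    rw [e, hAQ, hσ]
    exact submatrix_diagonal_equiv _ σ

theorem dotProduct_mulVec_le_sortedEigenvalues_zero {A : Matrix (Fin n) (Fin n) ℝ}
    (hA : A.IsHermitian) (hn : 0 < n) (w : Fin n → ℝ) :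
    w ⬝ᵥ A *ᵥ w ≤ sortedEigenvalues hA ⟨0, hn⟩ * (w ⬝ᵥ w) := by
  obtain ⟨U, hU, hU', hd⟩ := exists_orthogonal_diagonalization hA
  have hw : U *ᵥ (Uᵀ *ᵥ w) = w := by rw [mulVec_mulVec, hU', one_mulVec]
  have h := dotProduct_diagonal_mulVec_le (antitone_sortedEigenvalues hA) ⟨0, hn⟩
    (u := Uᵀ *ᵥ w) (fun i hi => absurd hi (Nat.not_lt_zero _))
  rwa [← hd, ← mulVec_dotProduct_mulVec_mulVec, ← mulVec_dotProduct_mulVec_self hU, hw] at h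

/-- Cauchy's interlacing inequality for a compression. -/
theorem sortedEigenvalues_compression_le {A : Matrix (Fin n) (Fin n) ℝ} (hA : A.IsHermitian)
    {V : Matrix (Fin n) (Fin m) ℝ} (hV : Vᵀ * V = 1) (hB : (Vᵀ * A * V).IsHermitian) (hmn : m ≤ n)
    (j : Fin m) : sortedEigenvalues hB j ≤ sortedEigenvalues hA (Fin.castLE hmn j) := by
  obtain ⟨U, hU, hU', hd⟩ := exists_orthogonal_diagonalization hA
  obtain ⟨Q, hQ, -, hdB⟩ := exists_orthogonal_diagonalization hB
  -- Vanishing of `L u` makes `V Q u` orthogonal to the first `j` eigenvectors of `A`, while `u`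
  -- stays in the span of the first `j + 1` coordinates; the Rayleigh quotient at `V Q u` then
  -- separates the two eigenvalues.
  let L : (Fin m → ℝ) →ₗ[ℝ] (Fin j → ℝ) :=
    (LinearMap.funLeft ℝ ℝ (Fin.castLE (j.2.le.trans hmn))) ∘ₗ (Uᵀ * V * Q).mulVecLin
  obtain ⟨u, hu0, hu, hLu⟩ := exists_ne_zero_supported L j
    ((Submodule.finrank_le _).trans (by rw [finrank_fin_fun]))
  set w := V *ᵥ (Q *ᵥ u) with hw
  have hUw : U *ᵥ (Uᵀ *ᵥ w) = w := by rw [mulVec_mulVec, hU', one_mulVec]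
  have hwu : w ⬝ᵥ w = u ⬝ᵥ u := by
    rw [hw, mulVec_dotProduct_mulVec_self hV, mulVec_dotProduct_mulVec_self hQ]
  have hup : w ⬝ᵥ A *ᵥ w ≤ sortedEigenvalues hA (Fin.castLE hmn j) * (w ⬝ᵥ w) := by
    have h := dotProduct_diagonal_mulVec_le (antitone_sortedEigenvalues hA) (Fin.castLE hmn j)
      (u := Uᵀ *ᵥ w) (fun i hi => by
        have h := congrFun hLu ⟨i, hi⟩
        simp only [L, LinearMap.comp_apply, LinearMap.funLeft_apply, mulVecLin_apply] at h
        rw [hw, mulVec_mulVec, mulVec_mulVec]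
        exact h)
    rwa [← hd, ← mulVec_dotProduct_mulVec_mulVec, ← mulVec_dotProduct_mulVec_self hU, hUw] at h
  have hlow := le_dotProduct_diagonal_mulVec (antitone_sortedEigenvalues hB) j hu
  rw [← hdB, ← mulVec_dotProduct_mulVec_mulVec, ← mulVec_dotProduct_mulVec_mulVec, ← hw,
    ← hwu] at hlow
  have hpos : 0 < w ⬝ᵥ w := by
    rw [hwu]
    exact lt_of_le_of_ne (by simpa using dotProduct_star_self_nonneg u)
      (Ne.symm (mt dotProduct_self_eq_zero.1 hu0))
  exact le_of_mul_le_mul_right (hlow.trans hup) hpos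

/-- Weyl's inequality: a perturbation `B` of rank at most `j` moves the eigenvalue `l j` of `A + B`
to at most the largest eigenvalue of `A`. -/
theorem le_sortedEigenvalues_zero_of_rank_le {A B : Matrix (Fin n) (Fin n) ℝ} (hA : A.IsHermitian)
    (hn : 0 < n) {W : Matrix (Fin n) (Fin n) ℝ} (hW : Wᵀ * W = 1) {l : Fin n → ℝ}
    (hl : Antitone l) (hWl : Wᵀ * (B + A) * W = diagonal l) (j : Fin n) (hB : B.rank ≤ j) :
    l j ≤ sortedEigenvalues hA ⟨0, hn⟩ := by
  -- A vector in the span of the top `j + 1` eigenvectors of `B + A` which `B` kills: there the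
  -- quadratic forms of `B + A` and `A` agree.
  obtain ⟨u, hu0, hu, hLu⟩ := exists_ne_zero_supported (B * W).mulVecLin j
    ((rank_mul_le_left B W).trans hB)
  set w := W *ᵥ u with hw
  have hBw : B *ᵥ w = 0 := by rw [hw, mulVec_mulVec]; exact hLu
  have hlow := le_dotProduct_diagonal_mulVec hl j hu
  rw [← hWl, ← mulVec_dotProduct_mulVec_mulVec, ← hw, add_mulVec, hBw, zero_add,
    ← mulVec_dotProduct_mulVec_self hW, ← hw] at hlow
  have hpos : 0 < w ⬝ᵥ w := by
    rw [hw, mulVec_dotProduct_mulVec_self hW]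
    exact lt_of_le_of_ne (by simpa using dotProduct_star_self_nonneg u)
      (Ne.symm (mt dotProduct_self_eq_zero.1 hu0))
  exact le_of_mul_le_mul_right
    (hlow.trans (dotProduct_mulVec_le_sortedEigenvalues_zero hA hn w)) hpos

theorem det_eq_prod_sortedEigenvalues {A : Matrix (Fin n) (Fin n) ℝ} (hA : A.IsHermitian) :
    A.det = ∏ i, sortedEigenvalues hA i := by
  obtain ⟨σ, hσ⟩ := exists_sortedEigenvalues_eq_comp hA
  rw [hA.det_eq_prod_eigenvalues, hσ]
  exact (Equiv.prod_comp σ hA.eigenvalues).symm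

theorem sortedEigenvalues_pos {A : Matrix (Fin n) (Fin n) ℝ} (hA : A.PosDef) (i : Fin n) :
    0 < sortedEigenvalues hA.isHermitian i := by
  obtain ⟨σ, hσ⟩ := exists_sortedEigenvalues_eq_comp hA.isHermitian
  rw [hσ]
  exact hA.eigenvalues_pos _

theorem det_compression_le {A : Matrix (Fin n) (Fin n) ℝ} (hA : A.PosDef)
    {V : Matrix (Fin n) (Fin m) ℝ} (hV : Vᵀ * V = 1) (hmn : m ≤ n) (hB : (Vᵀ * A * V).PosDef) :
    (Vᵀ * A * V).det ≤ ∏ j, sortedEigenvalues hA.isHermitian (Fin.castLE hmn j) := by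
  rw [det_eq_prod_sortedEigenvalues hB.isHermitian]
  exact Finset.prod_le_prod (fun j _ => (sortedEigenvalues_pos hB j).le)
    fun j _ => sortedEigenvalues_compression_le hA.isHermitian hV hB.isHermitian hmn j

end Eigenvalues

/-! ### The PCA rotation and the two determinant bounds. -/

section Rotation

open Matrix

variable {M K : ℕ}

/-- The matrix `W` with its columns split into the first `M` and the last `K` ones. -/
def splitColumns (W : Matrix (Fin (M + K)) (Fin (M + K)) ℝ) :
    Matrix (Fin (M + K)) (Fin M ⊕ Fin K) ℝ :=
  W.submatrix id finSumFinEquiv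

/-- The summand `0` gives the affine form required by `covMatrix_mulVec_add`. -/
theorem stack_firstPart_lastPart_rotate (W : Matrix (Fin (M + K)) (Fin (M + K)) ℝ)
    (x : EuclideanSpace ℝ (Fin (M + K))) :
    stack (firstPart (rotate W x)) (lastPart (rotate W x)) =
      WithLp.toLp 2 ((splitColumns W)ᵀ *ᵥ x.ofLp + 0) := by
  ext s
  cases s <;> simp [stack, firstPart, lastPart, rotate, splitColumns, mulVec, dotProduct]

theorem firstPart_rotate_add (W : Matrix (Fin (M + K)) (Fin (M + K)) ℝ)
    (x y : EuclideanSpace ℝ (Fin (M + K))) :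
    firstPart (rotate W (x + y)) = firstPart (rotate W x) + firstPart (rotate W y) := by
  ext i
  simp [firstPart, rotate, mulVec, dotProduct, mul_add, Finset.sum_add_distrib]

theorem lastPart_rotate_add (W : Matrix (Fin (M + K)) (Fin (M + K)) ℝ)
    (x y : EuclideanSpace ℝ (Fin (M + K))) :
    lastPart (rotate W (x + y)) = lastPart (rotate W x) + lastPart (rotate W y) := by
  ext i
  simp [lastPart, rotate, mulVec, dotProduct, mul_add, Finset.sum_add_distrib]

@[fun_prop]
theorem measurable_firstPart_rotate (W : Matrix (Fin (M + K)) (Fin (M + K)) ℝ) :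
    Measurable fun x => firstPart (rotate W x) := by
  have h : Continuous fun x : EuclideanSpace ℝ (Fin (M + K)) => firstPart (rotate W x) := by
    unfold firstPart rotate
    fun_prop
  exact h.measurable

@[fun_prop]
theorem measurable_lastPart_rotate (W : Matrix (Fin (M + K)) (Fin (M + K)) ℝ) :
    Measurable fun x => lastPart (rotate W x) := by
  have h : Continuous fun x : EuclideanSpace ℝ (Fin (M + K)) => lastPart (rotate W x) := by
    unfold lastPart rotate
    fun_prop
  exact h.measurable

theorem splitColumns_mul_transpose {W : Matrix (Fin (M + K)) (Fin (M + K)) ℝ} (hW : W * Wᵀ = 1) :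
    splitColumns W * (splitColumns W)ᵀ = 1 := by
  rw [splitColumns, transpose_submatrix, submatrix_mul_equiv, hW, submatrix_id_id]

theorem transpose_splitColumns_mul_mul (W C : Matrix (Fin (M + K)) (Fin (M + K)) ℝ) :
    (splitColumns W)ᵀ * C * splitColumns W =
      (Wᵀ * C * W).submatrix finSumFinEquiv finSumFinEquiv := rfl

theorem posDef_transpose_splitColumns_mul_mul {W C : Matrix (Fin (M + K)) (Fin (M + K)) ℝ}
    (hW : Wᵀ * W = 1) (hC : C.PosDef) :
    ((splitColumns W)ᵀ * C * splitColumns W).PosDef := by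
  rw [transpose_splitColumns_mul_mul]
  refine PosDef.submatrix ?_ finSumFinEquiv.injective
  rw [← conjTranspose_eq_transpose_of_trivial]
  refine hC.conjTranspose_mul_mul_same fun u v huv => ?_
  have h := congrArg (fun w => Wᵀ *ᵥ w) huv
  simpa [mulVec_mulVec, hW] using h

theorem absolutelyContinuous_map_firstPart_rotate {W : Matrix (Fin (M + K)) (Fin (M + K)) ℝ}
    (hW : Wᵀ * W = 1) {μ : Measure (EuclideanSpace ℝ (Fin (M + K)))} (hμ : μ ≪ volume) :
    μ.map (fun x => firstPart (rotate W x)) ≪ volume := by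
  let L : EuclideanSpace ℝ (Fin (M + K)) →ₗ[ℝ] EuclideanSpace ℝ (Fin M) :=
    { toFun := fun x => firstPart (rotate W x)
      map_add' := firstPart_rotate_add W
      map_smul' := fun c x => by
        ext i
        simp [firstPart, rotate, mulVec, dotProduct, Finset.mul_sum, mul_left_comm] }
  have hL : Function.Surjective L := by
    intro y
    refine ⟨WithLp.toLp 2 (W *ᵥ Fin.append y.ofLp (0 : Fin K → ℝ)), ?_⟩
    ext i
    simp [L, firstPart, rotate, mulVec_mulVec, hW]
  -- A surjective linear map sends Lebesgue measure to a multiple of Lebesgue measure. The factor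
  -- may be infinite, which does not affect absolute continuity.
  obtain ⟨c, -, hc⟩ := L.exists_map_addHaar_eq_smul_addHaar volume volume hL
  have h := hμ.map (measurable_firstPart_rotate W)
  have e : (volume : Measure (EuclideanSpace ℝ (Fin (M + K)))).map
    (fun x => firstPart (rotate W x)) = _ := hc
  rw [e] at h
  exact h.trans Measure.smul_absolutelyContinuous

/-- In the PCA basis the off-diagonal blocks vanish, so the Schur complement is diagonal. Its
entries have indices `M + j ≥ B.rank`, where Weyl's inequality applies. -/
theorem det_schurComplement_diagonal_le {W A B : Matrix (Fin (M + K)) (Fin (M + K)) ℝ}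
    (hA : A.PosDef) (hB : B.PosSemidef) (hn : 0 < M + K) (hrank : B.rank ≤ M)
    (hW : IsPCAMatrix (B + A) W) :
    (schurComplement ((splitColumns W)ᵀ * (B + A) * splitColumns W)).det ≤
      ∏ _j : Fin K, sortedEigenvalues hA.isHermitian ⟨0, hn⟩ := by
  obtain ⟨hWo, l, hl, hWl⟩ := hW
  have hWW : Wᵀ * W = 1 := (mem_orthogonalGroup_iff' _ _).1 hWo
  have hd : Wᵀ * (B + A) * W = diagonal l := by
    rw [Matrix.mul_assoc, hWl, ← Matrix.mul_assoc, hWW, Matrix.one_mul]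
  have hpos := posDef_transpose_splitColumns_mul_mul hWW (PosDef.posSemidef_add hB hA)
  have hΓ : (splitColumns W)ᵀ * (B + A) * splitColumns W =
      diagonal (l ∘ finSumFinEquiv) := by
    rw [transpose_splitColumns_mul_mul, hd, submatrix_diagonal_equiv]
  rw [hΓ] at hpos ⊢
  have h21 : (diagonal (l ∘ finSumFinEquiv (m := M) (n := K))).toBlocks₂₁ = 0 := by
    ext i j
    simp [toBlocks₂₁]
  have h22 : (diagonal (l ∘ finSumFinEquiv (m := M) (n := K))).toBlocks₂₂ =
      diagonal fun j => l (Fin.natAdd M j) := by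
    ext i j
    simp [toBlocks₂₂, diagonal_apply]
  rw [schurComplement, h21, h22, Matrix.zero_mul, Matrix.zero_mul, sub_zero, det_diagonal]
  refine Finset.prod_le_prod (fun j _ => ?_) fun j _ => ?_
  · simpa using (hpos.diag_pos (i := Sum.inr j)).le
  · exact le_sortedEigenvalues_zero_of_rank_le hA.isHermitian hn hWW hl hd _
      (hrank.trans (by simp))

/-- The Schur determinant is `det A` over the determinant of the upper left block, and interlacing
bounds that block by the product of the `M` largest eigenvalues. -/
theorem prod_sortedEigenvalues_le_det_schurComplement
    {W A : Matrix (Fin (M + K)) (Fin (M + K)) ℝ} (hA : A.PosDef) (hW : Wᵀ * W = 1) :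
    ∏ j : Fin K, sortedEigenvalues hA.isHermitian (Fin.natAdd M j) ≤
      (schurComplement ((splitColumns W)ᵀ * A * splitColumns W)).det := by
  have hpos := posDef_transpose_splitColumns_mul_mul hW hA
  have hdet := det_eq_mul_det_schurComplement hpos
  have hdetA : ((splitColumns W)ᵀ * A * splitColumns W).det = A.det := by
    have h1 : Wᵀ.det * W.det = 1 := by rw [← det_mul, hW, det_one]
    rw [transpose_splitColumns_mul_mul, det_submatrix_equiv_self, det_mul, det_mul]
    linear_combination A.det * h1
  rw [hdetA, det_eq_prod_sortedEigenvalues hA.isHermitian, Fin.prod_univ_add] at hdet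
  have h11 := posDef_toBlocks₁₁ hpos
  have e : ((splitColumns W)ᵀ * A * splitColumns W).toBlocks₁₁ =
      (W.submatrix id (Fin.castAdd K))ᵀ * A * W.submatrix id (Fin.castAdd K) := rfl
  have hV : (W.submatrix id (Fin.castAdd K))ᵀ * W.submatrix id (Fin.castAdd K) = 1 := by
    have : (W.submatrix id (Fin.castAdd K))ᵀ * W.submatrix id (Fin.castAdd K) =
      (Wᵀ * W).submatrix (Fin.castAdd K) (Fin.castAdd K) := rfl
    rw [this, hW, submatrix_one _ (Fin.castAdd_injective M K)]
  have hle := det_compression_le hA hV (Nat.le_add_right M K) (e ▸ h11)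
  rw [← e] at hle
  have hprod : 0 < ∏ j : Fin K, sortedEigenvalues hA.isHermitian (Fin.natAdd M j) :=
    Finset.prod_pos fun j _ => sortedEigenvalues_pos hA _
  have hfirst : 0 < ∏ i : Fin M, sortedEigenvalues hA.isHermitian (Fin.castAdd K i) :=
    Finset.prod_pos fun j _ => sortedEigenvalues_pos hA _
  have hS := (posDef_schurComplement hpos).det_pos
  refine le_of_mul_le_mul_left ?_ hfirst
  rw [hdet]
  exact mul_le_mul_of_nonneg_right hle hS.le

end Rotation

theorem posDef_of_rank_eq_card {ι : Type*} [Fintype ι] [DecidableEq ι] {A : Matrix ι ι ℝ}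
    (hA : A.PosSemidef) (hrank : A.rank = Fintype.card ι) : A.PosDef := by
  refine hA.posDef_iff_det_ne_zero.2 fun h => ?_
  obtain ⟨v, hv0, hv⟩ := Matrix.exists_mulVec_eq_zero_iff.2 h
  have hk := A.mulVecLin.finrank_range_add_finrank_ker
  rw [Module.finrank_fintype_fun_eq_card] at hk
  have hr : Module.finrank ℝ (LinearMap.range A.mulVecLin) = Fintype.card ι := hrank
  have hbot : LinearMap.ker A.mulVecLin = ⊥ := Submodule.finrank_eq_zero.1 (by omega)
  exact hv0 (LinearMap.ker_eq_bot'.1 hbot v hv)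

end PCALoss

end

/-! ### Assembly of the bound. -/

theorem mainTheorem1 {Ω : Type*} [MeasurableSpace Ω] (P : Measure Ω) [IsProbabilityMeasure P]
    (M K : ℕ) (hn : 0 < M + K)
    (S N : Ω → EuclideanSpace ℝ (Fin (M + K)))
    (hS : Measurable S) (hN : Measurable N)
    (hS2 : MemLp S 2 P) (hN2 : MemLp N 2 P)
    (hSN : IndepFun S N P)
    (hN_cont : P.map N ≪ volume)
    (hS_rank : (PCALoss.covMatrix S P).rank ≤ M)
    (hN_rank : (PCALoss.covMatrix N P).rank = M + K)
    (W : Matrix (Fin (M + K)) (Fin (M + K)) ℝ)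
    (hW : PCALoss.IsPCAMatrix (PCALoss.covMatrix (fun ω => S ω + N ω) P) W)
    (hJ_fin : PCALoss.condDivergence
        (fun ω => PCALoss.lastPart (PCALoss.rotate W (N ω)))
        (fun ω => PCALoss.firstPart (PCALoss.rotate W (N ω))) P ≠ ∞)
    (hJ : PCALoss.condDivergence
        (fun ω => PCALoss.lastPart (PCALoss.rotate W (N ω)))
        (fun ω => PCALoss.firstPart (PCALoss.rotate W (N ω))) P ≤
      PCALoss.condDivergence
        (fun ω => PCALoss.lastPart (PCALoss.rotate W (S ω + N ω)))
        (fun ω => PCALoss.firstPart (PCALoss.rotate W (S ω + N ω))) P) :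
    PCALoss.relevantLoss S (fun ω => S ω + N ω)
        (fun x => PCALoss.firstPart (PCALoss.rotate W x)) P ≤
      ((1 / 2 * Real.log (∏ j : Fin K,
        PCALoss.sortedEigenvalues (PCALoss.covMatrix_isHermitian N P) ⟨0, hn⟩ /
          PCALoss.sortedEigenvalues (PCALoss.covMatrix_isHermitian N P) (Fin.natAdd M j)) : ℝ) :
        EReal) := by
  open PCALoss Matrix in
  have hWW : Wᵀ * W = 1 := (mem_orthogonalGroup_iff' _ _).1 hW.1
  have hWW' : W * Wᵀ = 1 := mul_eq_one_comm.1 hWW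
  have hproj {Z : Ω → EuclideanSpace ℝ (Fin (M + K))} (hZ : MemLp Z 2 P) (i : Fin (M + K)) :
      MemLp (fun ω => Z ω i) 2 P :=
    (EuclideanSpace.proj (𝕜 := ℝ) i).comp_memLp' hZ
  set X : Ω → EuclideanSpace ℝ (Fin (M + K)) := fun ω => S ω + N ω with hX
  have hXm : Measurable X := hS.add hN
  have hX2 : MemLp X 2 P := hS2.add hN2
  have hCN : (covMatrix N P).PosDef :=
    posDef_of_rank_eq_card (posSemidef_covMatrix (hproj hN2)) (by rw [hN_rank, Fintype.card_fin])
  have hCS : (covMatrix S P).PosSemidef := posSemidef_covMatrix (hproj hS2)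
  have hCX : covMatrix X P = covMatrix S P + covMatrix N P :=
    covMatrix_add (hproj hS2) (hproj hN2) hSN
  have hCXpos : (covMatrix X P).PosDef := by
    rw [hCX]
    exact PosDef.posSemidef_add hCS hCN
  have hcov {Z : Ω → EuclideanSpace ℝ (Fin (M + K))} (hZ : MemLp Z 2 P) :
      covMatrix (fun ω => stack (firstPart (rotate W (Z ω))) (lastPart (rotate W (Z ω)))) P =
        (splitColumns W)ᵀ * covMatrix Z P * splitColumns W := by
    simp_rw [stack_firstPart_lastPart_rotate]
    rw [covMatrix_mulVec_add (hproj hZ), transpose_transpose]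
  have hfirst2 {Z : Ω → EuclideanSpace ℝ (Fin (M + K))} (hZ : MemLp Z 2 P) (i : Fin M) :
      MemLp (fun ω => firstPart (rotate W (Z ω)) i) 2 P :=
    memLp_mulVec_apply (hproj hZ) Wᵀ (Fin.castAdd K i)
  have hlast2 {Z : Ω → EuclideanSpace ℝ (Fin (M + K))} (hZ : MemLp Z 2 P) (j : Fin K) :
      MemLp (fun ω => lastPart (rotate W (Z ω)) j) 2 P :=
    memLp_mulVec_apply (hproj hZ) Wᵀ (Fin.natAdd M j)
  -- Convolving an absolutely continuous law with any law keeps it absolutely continuous, so `S`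
  -- needs no density.
  have hX_cont : P.map X ≪ volume := by
    have h := hSN.map_add_eq_map_conv_map hS hN
    have : IsProbabilityMeasure (P.map N) := Measure.isProbabilityMeasure_map hN.aemeasurable
    change P.map (S + N) ≪ volume
    rw [h]
    exact Measure.conv_absolutelyContinuous hN_cont
  have hac {Z : Ω → EuclideanSpace ℝ (Fin (M + K))} (hZ : Measurable Z)
      (hZc : P.map Z ≪ volume) : P.map (fun ω => firstPart (rotate W (Z ω))) ≪ volume := by
    have h := absolutelyContinuous_map_firstPart_rotate hWW hZc
    rwa [Measure.map_map (measurable_firstPart_rotate W) hZ] at h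
  have hind : IndepFun S
      (fun ω => (firstPart (rotate W (N ω)), lastPart (rotate W (N ω)))) P :=
    hSN.comp (φ := id) (ψ := fun x => (firstPart (rotate W x), lastPart (rotate W x)))
      measurable_id (by fun_prop)
  have hposN := posDef_transpose_splitColumns_mul_mul hWW hCN
  have hposX := posDef_transpose_splitColumns_mul_mul hWW hCXpos
  have hbound : (1 / 2 * (Real.log (schurComplement
        ((splitColumns W)ᵀ * covMatrix X P * splitColumns W)).det -
      Real.log (schurComplement ((splitColumns W)ᵀ * covMatrix N P * splitColumns W)).det)) ≤
      1 / 2 * Real.log (∏ j : Fin K, sortedEigenvalues (covMatrix_isHermitian N P) ⟨0, hn⟩ /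
        sortedEigenvalues (covMatrix_isHermitian N P) (Fin.natAdd M j)) := by
    have h1 : (schurComplement ((splitColumns W)ᵀ * covMatrix X P * splitColumns W)).det ≤
        ∏ _j : Fin K, sortedEigenvalues hCN.isHermitian ⟨0, hn⟩ := by
      rw [hCX] at hW ⊢
      exact det_schurComplement_diagonal_le hCN hCS hn hS_rank hW
    have h2 := prod_sortedEigenvalues_le_det_schurComplement hCN hWW
    have h3 : 0 < ∏ _j : Fin K, sortedEigenvalues hCN.isHermitian ⟨0, hn⟩ :=
      Finset.prod_pos fun j _ => sortedEigenvalues_pos hCN _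
    have h4 : 0 < ∏ j : Fin K, sortedEigenvalues hCN.isHermitian (Fin.natAdd M j) :=
      Finset.prod_pos fun j _ => sortedEigenvalues_pos hCN _
    rw [Finset.prod_div_distrib, Real.log_div h3.ne' h4.ne']
    have h5 := Real.log_le_log (posDef_schurComplement hposX).det_pos h1
    have h6 := Real.log_le_log h4 h2
    linarith
  refine iSup_le fun k => iSup_le fun q => iSup_le fun hq => ?_
  have hne : Nonempty (Fin k) := ⟨q 0⟩
  have hpair := mutualInfo_pair_sub_le (P := P) hq hS
    (N₁ := fun ω => firstPart (rotate W (N ω))) (N₂ := fun ω => lastPart (rotate W (N ω)))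
    (Y₁ := fun ω => firstPart (rotate W (X ω))) (Y₂ := fun ω => lastPart (rotate W (X ω)))
    ((measurable_firstPart_rotate W).comp hN) ((measurable_lastPart_rotate W).comp hN)
    (measurable_firstPart_rotate W) (measurable_lastPart_rotate W)
    (funext fun ω => firstPart_rotate_add W _ _) (funext fun ω => lastPart_rotate_add W _ _)
    hind (hfirst2 hN2) (hlast2 hN2) (hfirst2 hX2) (hlast2 hX2)
    (by rw [hcov hN2]; exact hposN) (by rw [hcov hX2]; exact hposX)
    (hac hN hN_cont) (hac hXm hX_cont) hJ_fin hJ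
  rw [hcov hN2, hcov hX2] at hpair
  -- It remains to see `I(Ŝ; X) ≤ I(Ŝ; Y_M, R)`: adding the regression value to `R` and rotating
  -- back recovers `X` measurably.
  refine le_trans (EReal.sub_le_sub ?_ le_rfl) (hpair.trans (EReal.coe_le_coe_iff.2 hbound))
  obtain ⟨r, hr, hres⟩ : ∃ r : EuclideanSpace ℝ (Fin M) → EuclideanSpace ℝ (Fin K),
      Measurable r ∧ ∀ ω, residual (fun ω => lastPart (rotate W (X ω)))
        (fun ω => firstPart (rotate W (X ω))) P ω =
          lastPart (rotate W (X ω)) - r (firstPart (rotate W (X ω))) :=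
    ⟨_, measurable_regression _ _, fun _ => rfl⟩
  have hY₁ := (measurable_firstPart_rotate W).comp hXm
  have hY₂ := (measurable_lastPart_rotate W).comp hXm
  have hstack : Continuous fun p : EuclideanSpace ℝ (Fin M) × EuclideanSpace ℝ (Fin K) =>
      (WithLp.toLp 2 (splitColumns W *ᵥ (stack p.1 p.2).ofLp) :
        EuclideanSpace ℝ (Fin (M + K))) := by
    refine (PiLp.continuous_toLp 2 _).comp (Continuous.matrix_mulVec continuous_const
      (continuous_pi fun s => ?_))
    cases s <;> simp [stack] <;> fun_prop
  have hg : Measurable fun p : EuclideanSpace ℝ (Fin M) × EuclideanSpace ℝ (Fin K) =>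
      (WithLp.toLp 2 (splitColumns W *ᵥ (stack p.1 (p.2 + r p.1)).ofLp) :
        EuclideanSpace ℝ (Fin (M + K))) :=
    hstack.measurable.comp (f := fun p : EuclideanSpace ℝ (Fin M) × EuclideanSpace ℝ (Fin K) =>
      (p.1, p.2 + r p.1)) (by fun_prop)
  have hle := mutualInfo_comp_le P (T := fun ω => q (S ω)) (hq.comp hS)
    (hY₁.prodMk (measurable_residual (P := P) hY₂ hY₁)) hg
  have hX' : (fun ω => (WithLp.toLp 2 (splitColumns W *ᵥ (stack (firstPart (rotate W (X ω)))
      (residual (fun ω => lastPart (rotate W (X ω))) (fun ω => firstPart (rotate W (X ω))) P ω +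
        r (firstPart (rotate W (X ω))))).ofLp) : EuclideanSpace ℝ (Fin (M + K)))) = X := by
    funext ω
    rw [hres, sub_add_cancel, stack_firstPart_lastPart_rotate, add_zero, mulVec_mulVec,
      splitColumns_mul_transpose hWW', one_mulVec]
  refine EReal.coe_ennreal_le_coe_ennreal_iff.2 (le_trans (le_of_eq ?_) hle)
  exact congrArg (fun Z => mutualInfo (fun ω => q (S ω)) Z P) hX'.symm
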